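/- Let $n\ge 2$ and let $M$ be a simply-connected non-flat space form of dimension $n$: either $M=S^n=\{x\in\mathbb V:\langle x,x\rangle=1\}$, where $\mathbb V=\mathbb R^{n+1}$ with the Euclidean inner product, or $M=H^n=\{x\in\mathbb V:\langle x,x\rangle=-1,\ x_{n+1}>0\}$, where $\mathbb V=\mathbb R^{n,1}$ is $\mathbb R^{n+1}$ with the Lorentzian inner product $\langle x,y\rangle=x_1y_1+\dots+x_ny_n-x_{n+1}y_{n+1}$; $M$ carries the induced Riemannian metric. For $p,q\in\mathbb R$ let $h_{p,q}$ be the generalised Cheeger–Gromoll metric on $TM$, $$h_{p,q}(A,B)=\langle d\pi A,d\pi B\rangle+(1+|e|^2)^{-p}\bigl(\langle KA,KB\rangle+q\langle KA,e\rangle\langle KB,e\rangle\bigr),\qquad A,B\in T_e(TM),$$ where $\pi:TM\to M$ is the projection and $K$ the Levi-Civita connection map. A smooth vector field $\sigma$ on $M$ is $(p,q)$-harmonic if it is a harmonic section of $TM$ with respect to $h_{p,q}$, that is, a critical point, with respect to compactly supported variations $\sigma+t\varphi$ through vector fields, of the vertical energy $$\tfrac12\int_M |d^v\sigma|^2=\tfrac12\int_M(1+|\sigma|^2)^{-p}\sum_i\bigl(|\nabla_{E_i}\sigma|^2+q\langle\nabla_{E_i}\sigma,\sigma\rangle^2\bigr)\,d\mathrm{vol}$$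 ($\{E_i\}$ a local orthonormal frame; if $M$ is not compact the integral is taken over compact sets containing the support of $\varphi$). The field $\sigma$ is harmonic if it is $(p,q)$-harmonic for some pair $(p,q)$; such pairs are called metric parameters for $\sigma$, and $\sigma$ is metrically unique if it has exactly one such pair. **Theorem 2.2.** Let $a\in\mathbb V$, $\mu=\langle a,a\rangle$, $\alpha(x)=\langle a,x\rangle$ for $x\in M$, and let $\sigma=\nabla\alpha$ be the conformal gradient field on $M$ with pole $a$. Assume that $\sigma$ is non-trivial (not identically zero). (1) $\mu\ge0$ if and only if $M=S^n$, or $M=H^n$ and $\sigma$ has no zeros. In this case $\sigma$ is harmonic if and only if $n>2$ and $\mu=1/(n-2)$; and if $\sigma$ is harmonic then it is metrically unique, with metric parameters $(p,q)=(n+1,\,2-n)$. (2) $\mu<0$ if and only if $M=H^n$ and $\sigma$ has a zero. In this case $\sigma$ is harmonic if and only if $\mu=-1$. If $\sigma$ is harmonic and $n=2$, then $\sigma$ is metrically unique, with metric parameters $(3,-1/2)$; if $\sigma$ is harmonic and $n>2$, then $\sigma$ has precisely two pairs of metric parameters, namely $$(p,q)=\Bigl(n+1,\ 1-n+\frac1n\Bigr)\quad\text{and}\quad(p,q)=\Bigl(\frac1{2-n},\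 0\Bigr).$$ -/

import Mathlib

open scoped ContDiff

noncomputable section

namespace SpaceForm

/-- The two families of simply-connected non-flat space forms: the unit spheres and the real
hyperbolic spaces (in the hyperboloid model). -/
inductive Kind
  | sphere
  | hyperbolic

/-- The indicator `ε`: it is `1` for spheres and `-1` for hyperbolic spaces. -/
def Kind.sign : Kind → ℝ
  | .sphere => 1
  | .hyperbolic => -1

/-- The vector space `ℝⁿ⁺¹` that underlies the ambient space `𝕍`. Its Euclidean structure is used
only for topology, derivatives and Lebesgue measure; the geometry comes from `form`. -/
abbrev Ambient (n : ℕ) := EuclideanSpace ℝ (Fin (n + 1))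

/-- The signature of the ambient inner product: `⟨e_i, e_i⟩` for the standard basis `e_i`. -/
def signature (M : Kind) {n : ℕ} (i : Fin (n + 1)) : ℝ :=
  if i = Fin.last n then M.sign else 1

/-- The ambient inner product `⟨x, y⟩ = x₁ y₁ + ⋯ + xₙ yₙ + ε xₙ₊₁ yₙ₊₁`:
Euclidean for the sphere, Lorentzian for hyperbolic space. -/
def form (M : Kind) {n : ℕ} (x y : Ambient n) : ℝ :=
  ∑ i, signature M i * x i * y i

/-- The space form itself: `Sⁿ = {⟨x, x⟩ = 1}`, or `Hⁿ = {⟨x, x⟩ = -1, xₙ₊₁ > 0}`. -/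
def points (M : Kind) (n : ℕ) : Set (Ambient n) :=
  match M with
  | .sphere => {x | form .sphere x x = 1}
  | .hyperbolic => {x | form .hyperbolic x x = -1 ∧ 0 < x (Fin.last n)}

/-- `X` is tangent to the space form at its point `x`; that is, `X` is orthogonal to `x`. -/
def IsTangent (M : Kind) {n : ℕ} (x X : Ambient n) : Prop := form M x X = 0

/-- The orthogonal projection of `𝕍` onto the tangent space at the point `x`
(recall that `⟨x, x⟩ = ε`). -/
def tangentProj (M : Kind) {n : ℕ} (x v : Ambient n) : Ambient n :=
  v - (M.sign * form M x v) • x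

/-- The orthogonal projection onto the tangent space at `x` of the `i`-th standard basis vector. -/
def tangentBasisVec (M : Kind) {n : ℕ} (x : Ambient n) (i : Fin (n + 1)) : Ambient n :=
  tangentProj M x (EuclideanSpace.single i 1)

/-- `E` is an orthonormal basis of the tangent space at `x`. -/
def IsOrthonormalFrame (M : Kind) {n : ℕ} (x : Ambient n) (E : Fin n → Ambient n) : Prop :=
  (∀ i, IsTangent M x (E i)) ∧ ∀ i j, form M (E i) (E j) = if i = j then 1 else 0

/-- The trace, with respect to the Riemannian metric, of a bilinear form `b` on the tangent space
at `x`. Projecting the inverse metric `∑ ⟨e_i, e_i⟩ e_i ⊗ e_i` of `𝕍` to the tangent space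
gives the inverse of the induced metric. By `metricTrace_eq_sum` below, the value is
`∑ b (E_i, E_i)` for every orthonormal basis `E` of the tangent space. -/
def metricTrace (M : Kind) {n : ℕ} (x : Ambient n) (b : Ambient n → Ambient n → ℝ) : ℝ :=
  ∑ i, signature M i * b (tangentBasisVec M x i) (tangentBasisVec M x i)

/-- A smooth (tangent) vector field. The space form is a closed submanifold of `𝕍`, so its
smooth vector fields are exactly the restrictions to it of smooth maps `Y : 𝕍 → 𝕍` which are
tangent to it at its points. We work with such maps; only their values along the space form
matter below. -/
structure IsVectorField (M : Kind) {n : ℕ} (Y : Ambient n → Ambient n) : Prop where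
  smooth : ContDiff ℝ ∞ Y
  tangent : ∀ x ∈ points M n, IsTangent M x (Y x)

/-- The Levi-Civita covariant derivative `∇_X Y` at `x`, given by the Gauss formula: the tangential
part of the directional derivative `D_X Y`. -/
def covDeriv (M : Kind) {n : ℕ} (Y : Ambient n → Ambient n) (x X : Ambient n) : Ambient n :=
  tangentProj M x (fderiv ℝ Y x X)

/-- The gradient of (the restriction to the space form of) the function `f`, at the point `x`:
the tangent vector metrically dual to `df`, see `isTangent_grad` and `form_grad`. -/
def grad (M : Kind) {n : ℕ} (f : Ambient n → ℝ) (x : Ambient n) : Ambient n :=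
  ∑ i, (signature M i * fderiv ℝ f x (tangentBasisVec M x i)) • tangentBasisVec M x i

/-- The conformal gradient field with pole `a`: the gradient of the potential
`α(x) = ⟨a, x⟩`. -/
def conformalGradient (M : Kind) {n : ℕ} (a : Ambient n) : Ambient n → Ambient n :=
  grad M (fun x => form M a x)

/-- The connection map `K` of the tangent bundle. A tangent vector of the tangent bundle at
`e ∈ T_x` is the velocity `A = (x', e')` of a curve `(x(t), e(t))` with `e(t) ∈ T_{x(t)}`; then `K A`
is the covariant derivative of `e(t)` along `x(t)`. -/
def connectionMap (M : Kind) {n : ℕ} (x : Ambient n) (A : Ambient n × Ambient n) : Ambient n :=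
  tangentProj M x A.2

/-- The generalised Cheeger-Gromoll metric `h_{p,q}` on the tangent bundle, at the point `e` of the
tangent space at `x`:
`h_{p,q}(A, B) = ⟨dπ A, dπ B⟩ + (1 + |e|²)^{-p} (⟨K A, K B⟩ + q ⟨K A, e⟩ ⟨K B, e⟩)`.
Here `h_{0,0}` is the Sasaki metric and `h_{1,1}` the Cheeger-Gromoll metric. -/
def cheegerGromoll (M : Kind) (p q : ℝ) {n : ℕ} (x e : Ambient n)
    (A B : Ambient n × Ambient n) : ℝ :=
  form M A.1 B.1 + (1 + form M e e) ^ (-p) *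
    (form M (connectionMap M x A) (connectionMap M x B) +
      q * form M (connectionMap M x A) e * form M (connectionMap M x B) e)

/-- The vertical part of the differential `dY(X) = (X, D_X Y)` of the section `Y` of the tangent
bundle: the vector tangent to the fibre with the same image `∇_X Y` under the connection map. -/
def verticalDifferential (M : Kind) {n : ℕ} (Y : Ambient n → Ambient n) (x X : Ambient n) :
    Ambient n × Ambient n :=
  (0, covDeriv M Y x X)

/-- The vertical energy density `½ |dᵛY|²` of `Y` with respect to `h_{p,q}`. -/
def verticalEnergyDensity (M : Kind) (p q : ℝ) {n : ℕ} (Y : Ambient n → Ambient n)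
    (x : Ambient n) : ℝ :=
  (1 / 2) * metricTrace M x fun X X' =>
    cheegerGromoll M p q x (Y x) (verticalDifferential M Y x X) (verticalDifferential M Y x X')

/-- The open cone of all `t x` with `t > 0` and `x` in the space form. -/
def openCone (M : Kind) (n : ℕ) : Set (Ambient n) :=
  {v | ∃ t : ℝ, 0 < t ∧ ∃ x ∈ points M n, v = t • x}

/-- The Riemannian volume measure of the space form, as a measure on `𝕍` which is carried by the
space form. In polar coordinates `v = r x` on the open cone, Lebesgue measure is
`rⁿ dr dvol(x)`, for the Euclidean as for the Lorentzian inner product; so the volume of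
a subset of the space form is `n + 1` times the Lebesgue measure of the part `0 < r < 1` of the cone
over it. -/
def volumeMeasure (M : Kind) (n : ℕ) : MeasureTheory.Measure (Ambient n) :=
  ((n : ENNReal) + 1) •
    ((MeasureTheory.volume.restrict (openCone M n ∩ {v | M.sign * form M v v < 1})).map
      fun v => (√(M.sign * form M v v))⁻¹ • v)

/-- The vertical energy of `Y` over the part of the space form in `K`. -/
def verticalEnergy (M : Kind) (p q : ℝ) {n : ℕ} (K : Set (Ambient n))
    (Y : Ambient n → Ambient n) : ℝ :=
  ∫ x in K, verticalEnergyDensity M p q Y x ∂(volumeMeasure M n)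

/-- `σ` is `(p, q)`-harmonic: it is a harmonic section of the tangent bundle with respect to
`h_{p,q}`, that is, a critical point of the vertical energy with respect to compactly supported
variations `σ + t φ` through vector fields. -/
def IsPQHarmonic (M : Kind) (p q : ℝ) {n : ℕ} (σ : Ambient n → Ambient n) : Prop :=
  IsVectorField M σ ∧
    ∀ (K : Set (Ambient n)) (φ : Ambient n → Ambient n), IsCompact K → IsVectorField M φ →
      tsupport φ ⊆ K →
      HasDerivAt (fun t : ℝ => verticalEnergy M p q K (fun x => σ x + t • φ x)) 0 0

/-- The set of all pairs `(p, q)` of metric parameters for `σ`. -/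
def metricParameters (M : Kind) {n : ℕ} (σ : Ambient n → Ambient n) : Set (ℝ × ℝ) :=
  {r | IsPQHarmonic M r.1 r.2 σ}

/-- `σ` is a harmonic vector field: it is `(p, q)`-harmonic for some pair `(p, q)`. -/
def IsHarmonic (M : Kind) {n : ℕ} (σ : Ambient n → Ambient n) : Prop :=
  ∃ p q : ℝ, IsPQHarmonic M p q σ

section Facts

variable (M : Kind) {n : ℕ}

theorem sign_mul_sign : M.sign * M.sign = 1 := by
  cases M <;> simp [Kind.sign]

theorem form_self_of_mem {x : Ambient n} (hx : x ∈ points M n) : form M x x = M.sign := by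
  cases M
  · exact hx
  · exact hx.1

theorem signature_mul_self (i : Fin (n + 1)) : signature M i * signature M i = 1 := by
  unfold signature
  split_ifs
  · exact sign_mul_sign M
  · norm_num

theorem form_comm (x y : Ambient n) : form M x y = form M y x :=
  Finset.sum_congr rfl fun i _ => by ring

/-- The ambient inner product as a bilinear form. -/
def formBilin : Ambient n →ₗ[ℝ] Ambient n →ₗ[ℝ] ℝ :=
  LinearMap.mk₂ ℝ (form M)
    (fun x y z => by
      simp only [form, PiLp.add_apply, ← Finset.sum_add_distrib]
      exact Finset.sum_congr rfl fun i _ => by ring)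
    (fun c x y => by
      simp only [form, PiLp.smul_apply, smul_eq_mul, Finset.mul_sum]
      exact Finset.sum_congr rfl fun i _ => by ring)
    (fun x y z => by
      simp only [form, PiLp.add_apply, ← Finset.sum_add_distrib]
      exact Finset.sum_congr rfl fun i _ => by ring)
    (fun c x y => by
      simp only [form, PiLp.smul_apply, smul_eq_mul, Finset.mul_sum]
      exact Finset.sum_congr rfl fun i _ => by ring)

theorem formBilin_apply (x y : Ambient n) : formBilin M x y = form M x y := rfl

/-- The projection to the tangent space as a linear map. -/
def tangentProjLin (x : Ambient n) : Ambient n →ₗ[ℝ] Ambient n :=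
  LinearMap.id - (M.sign • formBilin M x).smulRight x

theorem tangentProjLin_apply (x v : Ambient n) : tangentProjLin M x v = tangentProj M x v := by
  simp [tangentProjLin, tangentProj, formBilin_apply]

theorem form_single (i : Fin (n + 1)) (v : Ambient n) :
    form M (EuclideanSpace.single i 1) v = signature M i * v i := by
  unfold form
  rw [Finset.sum_eq_single i]
  · simp
  · intro j _ hj
    simp [hj]
  · simp

theorem sum_signature_smul (v : Ambient n) :
    ∑ i, (signature M i * form M (EuclideanSpace.single i 1) v) •
      (EuclideanSpace.single i 1 : Ambient n) = v := by
  have h : ∀ i, signature M i * form M (EuclideanSpace.single i 1) v = v i := fun i => by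
    rw [form_single, ← mul_assoc, signature_mul_self, one_mul]
  simp only [h]
  ext j
  simp [Finset.sum_apply, Pi.single_apply]

theorem tangentProj_of_isTangent {x X : Ambient n} (hX : IsTangent M x X) :
    tangentProj M x X = X := by
  have h : form M x X = 0 := hX
  simp [tangentProj, h]

theorem isTangent_tangentProj {x : Ambient n} (hx : x ∈ points M n) (v : Ambient n) :
    IsTangent M x (tangentProj M x v) := by
  change formBilin M x (tangentProj M x v) = 0
  simp only [tangentProj, map_sub, map_smul, formBilin_apply, smul_eq_mul, form_self_of_mem M hx]
  linear_combination (-form M x v) * sign_mul_sign M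

theorem form_tangentProj_left {x X : Ambient n} (hX : IsTangent M x X) (v : Ambient n) :
    form M (tangentProj M x v) X = form M v X := by
  have h : form M x X = 0 := hX
  rw [← formBilin_apply, tangentProj, map_sub, map_smul]
  simp [formBilin_apply, h]

theorem isTangent_grad {x : Ambient n} (hx : x ∈ points M n) (f : Ambient n → ℝ) :
    IsTangent M x (grad M f x) := by
  change formBilin M x (grad M f x) = 0
  rw [grad, map_sum]
  refine Finset.sum_eq_zero fun i _ => ?_
  have h : form M x (tangentBasisVec M x i) = 0 := isTangent_tangentProj M hx _
  simp [formBilin_apply, h]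

/-- The defining property `⟨∇f, X⟩ = df(X)` of the gradient. -/
theorem form_grad {x X : Ambient n} (hX : IsTangent M x X) (f : Ambient n → ℝ) :
    form M (grad M f x) X = fderiv ℝ f x X := by
  have h1 : X = ∑ i, (signature M i * form M (EuclideanSpace.single i 1) X) •
      tangentBasisVec M x i := by
    conv_lhs => rw [← tangentProj_of_isTangent M hX, ← tangentProjLin_apply,
      ← sum_signature_smul M X]
    simp only [map_sum, map_smul, tangentProjLin_apply, tangentBasisVec]
  conv_rhs => rw [h1]
  rw [← formBilin_apply, grad, map_sum, map_sum, LinearMap.sum_apply]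
  refine Finset.sum_congr rfl fun i _ => ?_
  simp only [map_smul, LinearMap.smul_apply, formBilin_apply, smul_eq_mul]
  rw [tangentBasisVec, form_tangentProj_left M hX]
  ring

/-- An orthonormal basis of the tangent space computes the projection to it. -/
theorem tangentProj_eq_sum {x : Ambient n} (hx : x ∈ points M n) {E : Fin n → Ambient n}
    (hE : IsOrthonormalFrame M x E) (v : Ambient n) :
    tangentProj M x v = ∑ i, form M v (E i) • E i := by
  obtain ⟨hT, hO⟩ := hE
  have hT' : ∀ i, form M (E i) x = 0 := fun i => by rw [form_comm]; exact hT i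
  have hli : LinearIndependent ℝ (Fin.cons x E : Fin (n + 1) → Ambient n) := by
    rw [Fintype.linearIndependent_iff]
    intro g hg
    rw [Fin.sum_univ_succ] at hg
    simp only [Fin.cons_zero, Fin.cons_succ] at hg
    have h0 : g 0 = 0 := by
      have := congrArg (formBilin M x) hg
      have hT'' : ∀ i, form M x (E i) = 0 := hT
      simp only [map_add, map_sum, map_smul, formBilin_apply, form_self_of_mem M hx, hT'',
        smul_eq_mul, mul_zero, Finset.sum_const_zero, add_zero, map_zero] at this
      linear_combination M.sign * this - g 0 * sign_mul_sign M
    intro i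
    refine Fin.cases h0 (fun j => ?_) i
    have := congrArg (formBilin M (E j)) hg
    simpa only [map_add, map_sum, map_smul, map_zero, formBilin_apply, hO, hT', smul_eq_mul,
      mul_zero, zero_add, mul_ite, mul_one, Finset.sum_ite_eq, Finset.mem_univ, if_true] using this
  have htop := hli.span_eq_top_of_card_eq_finrank' (by simp)
  have hv : v ∈ Submodule.span ℝ (Set.range (Fin.cons x E : Fin (n + 1) → Ambient n)) := by
    rw [htop]; trivial
  rw [← tangentProjLin_apply]
  induction hv using Submodule.span_induction with
  | mem y hy =>
    obtain ⟨i, rfl⟩ := hy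
    refine Fin.cases ?_ (fun j => ?_) i
    · have hT'' : ∀ i, form M x (E i) = 0 := hT
      simp [tangentProjLin_apply, tangentProj, form_self_of_mem M hx, sign_mul_sign, hT'']
    · rw [Fin.cons_succ, tangentProjLin_apply, tangentProj_of_isTangent M (hT j)]
      simp [hO]
  | zero => simp [← formBilin_apply]
  | add y z _ _ h1 h2 =>
    rw [map_add, h1, h2, ← Finset.sum_add_distrib]
    refine Finset.sum_congr rfl fun i _ => ?_
    simp [← formBilin_apply, add_smul]
  | smul c y _ h =>
    rw [map_smul, h, Finset.smul_sum]
    refine Finset.sum_congr rfl fun i _ => ?_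
    simp [← formBilin_apply, smul_smul]

/-- The metric trace is the sum over any orthonormal basis of the tangent space. -/
theorem metricTrace_eq_sum {x : Ambient n} (hx : x ∈ points M n) {E : Fin n → Ambient n}
    (hE : IsOrthonormalFrame M x E) (b : Ambient n →ₗ[ℝ] Ambient n →ₗ[ℝ] ℝ) :
    metricTrace M x (fun X Y => b X Y) = ∑ i, b (E i) (E i) := by
  have h : ∀ k, tangentBasisVec M x k =
      ∑ i, form M (EuclideanSpace.single k 1) (E i) • E i := fun k =>
    tangentProj_eq_sum M hx hE _
  have key : ∀ i j, ∑ k, signature M k * (form M (EuclideanSpace.single k 1) (E i) *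
      form M (EuclideanSpace.single k 1) (E j)) = if i = j then 1 else 0 := fun i j => by
    rw [← hE.2 i j, form]
    refine Finset.sum_congr rfl fun k _ => ?_
    rw [form_single, form_single]
    linear_combination (signature M k * E i k * E j k) * signature_mul_self M k
  unfold metricTrace
  simp only [h, map_sum, map_smul, LinearMap.sum_apply, LinearMap.smul_apply, smul_eq_mul,
    Finset.mul_sum]
  rw [Finset.sum_comm]
  have : ∀ i, ∑ k, ∑ j, signature M k * (form M (EuclideanSpace.single k 1) (E i) *
      (form M (EuclideanSpace.single k 1) (E j) * b (E j) (E i))) = b (E i) (E i) := fun i => by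
    rw [Finset.sum_comm]
    have h2 : ∀ j, ∑ k, signature M k * (form M (EuclideanSpace.single k 1) (E i) *
        (form M (EuclideanSpace.single k 1) (E j) * b (E j) (E i))) =
        (if i = j then 1 else 0) * b (E j) (E i) := fun j => by
      rw [← key i j, Finset.sum_mul]
      exact Finset.sum_congr rfl fun k _ => by ring
    simp [h2]
  rw [← Finset.sum_congr rfl fun i _ => this i]

/-- The vertical energy density in terms of an orthonormal basis of the tangent space. -/
theorem verticalEnergyDensity_eq_sum (p q : ℝ) {x : Ambient n} (hx : x ∈ points M n)
    {E : Fin n → Ambient n} (hE : IsOrthonormalFrame M x E) (Y : Ambient n → Ambient n) :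
    verticalEnergyDensity M p q Y x = (1 / 2) * ∑ i, (1 + form M (Y x) (Y x)) ^ (-p) *
      (form M (covDeriv M Y x (E i)) (covDeriv M Y x (E i)) +
        q * form M (covDeriv M Y x (E i)) (Y x) ^ 2) := by
  have hL : ∀ X, connectionMap M x (verticalDifferential M Y x X) = covDeriv M Y x X := fun X =>
    tangentProj_of_isTangent M (isTangent_tangentProj M hx _)
  let L : Ambient n →ₗ[ℝ] Ambient n := tangentProjLin M x ∘ₗ (fderiv ℝ Y x).toLinearMap
  have hLX : ∀ X, L X = covDeriv M Y x X := fun X => tangentProjLin_apply M x _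
  let ℓ : Ambient n →ₗ[ℝ] ℝ := (formBilin M).flip (Y x) ∘ₗ L
  let b : Ambient n →ₗ[ℝ] Ambient n →ₗ[ℝ] ℝ :=
    (1 + form M (Y x) (Y x)) ^ (-p) •
      ((formBilin M).compl₁₂ L L + q • (LinearMap.mul ℝ ℝ).compl₁₂ ℓ ℓ)
  have hb : ∀ X X', cheegerGromoll M p q x (Y x) (verticalDifferential M Y x X)
      (verticalDifferential M Y x X') = b X X' := fun X X' => by
    have h0 : form M (0 : Ambient n) 0 = 0 := by simp [← formBilin_apply]
    simp only [cheegerGromoll, hL]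
    simp [verticalDifferential, b, ℓ, hLX, formBilin_apply, h0, mul_assoc, mul_add]
  simp only [verticalEnergyDensity, hb]
  rw [metricTrace_eq_sum M hx hE b]
  congr 1
  refine Finset.sum_congr rfl fun i _ => ?_
  rw [← hb]
  have h0 : form M (0 : Ambient n) 0 = 0 := by simp [← formBilin_apply]
  simp only [cheegerGromoll, hL]
  simp only [verticalDifferential, h0]
  ring

end Facts

end SpaceForm

end

/-! Write `ε` for the sign, `α(x) = ⟨a, x⟩` and `w = 1 + |σ|²`. On the space form `σ = a - εα x`, so
`∇_X σ = -εα X` and `|σ|² = μ - εα²`. The vertical energy density and its first variation are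
therefore explicit in `α`.

In the first variation the derivatives of a test field `φ` enter only through `-εα w^(-p) (div φ + q
⟨∇_σ φ, σ⟩)`. Up to zeroth-order terms this is minus the divergence of the current `εα w^(-p) (φ + q
⟨φ, σ⟩ σ)`. What remains is `⟨φ, σ⟩ w^(-p-1)` times a quadratic polynomial in `α²`, namely
`tensionPoly`; this is `densityVariation_conformalGradient`. The divergence integrates to zero by
`integral_surfaceDiv_eq_zero`, which is reduced to Lebesgue measure on the cone over the space form.
Testing with cut-off multiples of `σ` shows that harmonicity means `tensionPoly` vanishes wherever
`σ ≠ 0` (`isPQHarmonic_conformalGradient_iff`).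

Since `σ` is non-trivial, `α` takes infinitely many values, so all three coefficients vanish
(`isPQHarmonic_conformalGradient_iff_eqs`): `(1 + μ)(1 + qμ) = 0`, `-1 + (2 - n)p + q((p - 2 - n)μ -
1 - n) = 0` and `q(1 + n - p) = 0`. If `μ ≥ 0`, the first equation gives `qμ = -1`, hence `q ≠ 0`,
`p = n + 1`, and then `q = 2 - n`. If `μ < 0`, only `μ = -1` survives: `p = n + 1` fixes `q`, while
`q = 0` forces `p = 1/(2 - n)` and needs `n > 2`. The sign of `μ` is matched with zeros of `σ` by
`form_self_nonneg_iff`. -/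

open scoped ContDiff

noncomputable section

namespace SpaceForm

/-! ### Linear algebra: positivity on tangent spaces and traces over the projected basis. -/

section Algebra

variable (M : Kind) {n : ℕ}

theorem form_add_left (x y z : Ambient n) : form M (x + y) z = form M x z + form M y z := by
  simp [← formBilin_apply]

theorem form_add_right (x y z : Ambient n) : form M x (y + z) = form M x y + form M x z := by
  simp [← formBilin_apply]

theorem form_sub_left (x y z : Ambient n) : form M (x - y) z = form M x z - form M y z := by
  simp [← formBilin_apply]

theorem form_sub_right (x y z : Ambient n) : form M x (y - z) = form M x y - form M x z := by
  simp [← formBilin_apply]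

theorem form_smul_left (c : ℝ) (x y : Ambient n) : form M (c • x) y = c * form M x y := by
  simp [← formBilin_apply]

theorem form_smul_right (c : ℝ) (x y : Ambient n) : form M x (c • y) = c * form M x y := by
  simp [← formBilin_apply]

theorem form_zero_left (x : Ambient n) : form M 0 x = 0 := by
  simp [← formBilin_apply]

theorem form_zero_right (x : Ambient n) : form M x 0 = 0 := by
  simp [← formBilin_apply]

theorem form_eq_sum_castSucc (x y : Ambient n) :
    form M x y = (∑ i : Fin n, x i.castSucc * y i.castSucc) +
      M.sign * x (Fin.last n) * y (Fin.last n) := by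
  simp only [form, signature, Fin.sum_univ_castSucc, if_true]
  congr 1
  refine Finset.sum_congr rfl fun i _ => ?_
  rw [if_neg (Fin.castSucc_lt_last i).ne, one_mul]

/-- In hyperbolic space, the last coordinate of a tangent vector is controlled by its norm. -/
theorem sq_last_le_of_isTangent {x X : Ambient n} (hx : x ∈ points .hyperbolic n)
    (hX : IsTangent .hyperbolic x X) :
    X (Fin.last n) ^ 2 ≤ (x (Fin.last n) ^ 2 - 1) * form .hyperbolic X X := by
  have h1 : form .hyperbolic x x = -1 := hx.1
  have h2 : form .hyperbolic x X = 0 := hX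
  rw [form_eq_sum_castSucc] at h1 h2 ⊢
  simp only [Kind.sign] at h1 h2 ⊢
  -- Cauchy–Schwarz on the first `n` coordinates; `⟨x, x⟩ = -1` and `⟨x, X⟩ = 0` then express both
  -- `∑ xᵢ²` and `∑ xᵢ Xᵢ` through last coordinates.
  have h3 := Finset.sum_mul_sq_le_sq_mul_sq Finset.univ (fun i : Fin n => x i.castSucc)
    (fun i : Fin n => X i.castSucc)
  simp only [pow_two] at h3 ⊢
  rw [show ∑ i : Fin n, x i.castSucc * X i.castSucc = x (Fin.last n) * X (Fin.last n) by linarith,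
    show ∑ i : Fin n, x i.castSucc * x i.castSucc = x (Fin.last n) * x (Fin.last n) - 1 by
      linarith] at h3
  linarith

theorem one_le_sq_last {x : Ambient n} (hx : x ∈ points .hyperbolic n) :
    1 ≤ x (Fin.last n) ^ 2 := by
  have h1 : form .hyperbolic x x = -1 := hx.1
  rw [form_eq_sum_castSucc] at h1
  simp only [Kind.sign] at h1
  have : 0 ≤ ∑ i : Fin n, x i.castSucc * x i.castSucc :=
    Finset.sum_nonneg fun i _ => mul_self_nonneg _
  nlinarith

theorem form_sphere_self (X : Ambient n) : form .sphere X X = ∑ i, X i ^ 2 := by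
  simp only [form, signature, Kind.sign, ite_self]
  exact Finset.sum_congr rfl fun i _ => by ring

theorem form_sphere_self_pos {X : Ambient n} (h : X ≠ 0) : 0 < form .sphere X X := by
  have : form .sphere X X = ‖X‖ ^ 2 := by
    rw [form_sphere_self, EuclideanSpace.norm_sq_eq]
    simp
  rw [this]
  positivity

/-- The induced metric is positive definite. -/
theorem form_self_pos_of_isTangent {x X : Ambient n} (hx : x ∈ points M n)
    (hX : IsTangent M x X) (h : X ≠ 0) : 0 < form M X X := by
  cases M
  · exact form_sphere_self_pos h
  · have h1 := sq_last_le_of_isTangent hx hX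
    have h2 := one_le_sq_last hx
    have h0 : form .hyperbolic X X = (∑ i : Fin n, X i.castSucc ^ 2) - X (Fin.last n) ^ 2 := by
      rw [form_eq_sum_castSucc]
      simp only [Kind.sign, pow_two]
      ring
    by_cases hl : X (Fin.last n) = 0
    · rw [h0, hl]
      have : ∃ i : Fin n, X i.castSucc ≠ 0 := by
        by_contra! hc
        refine h (PiLp.ext fun j => ?_)
        exact Fin.lastCases (by simpa using hl) (fun i => by simpa using hc i) j
      obtain ⟨i, hi⟩ := this
      have : 0 < ∑ i : Fin n, X i.castSucc ^ 2 :=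
        Finset.sum_pos' (fun i _ => sq_nonneg _) ⟨i, Finset.mem_univ _, by positivity⟩
      simpa using this
    · have : 0 < X (Fin.last n) ^ 2 := by positivity
      by_contra! hc
      nlinarith

theorem form_self_nonneg_of_isTangent {x X : Ambient n} (hx : x ∈ points M n)
    (hX : IsTangent M x X) : 0 ≤ form M X X := by
  by_cases h : X = 0
  · simp [h, form_zero_left]
  · exact (form_self_pos_of_isTangent M hx hX h).le

theorem form_tangentProj_comm (x v w : Ambient n) :
    form M (tangentProj M x v) w = form M v (tangentProj M x w) := by
  simp only [tangentProj, form_sub_left, form_sub_right, form_smul_left, form_smul_right,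
    form_comm M v x]
  ring

/-- The projected basis occurs twice in each term, and each occurrence moves one projection onto
`v`. Off the space form `tangentProj` is not idempotent, so both copies must be kept. -/
theorem sum_signature_smul_tangentBasisVec (x v : Ambient n) :
    ∑ i, (signature M i * form M v (tangentBasisVec M x i)) • tangentBasisVec M x i =
      tangentProj M x (tangentProj M x v) := by
  rw [← tangentProjLin_apply M x (tangentProj M x v)]
  conv_rhs => rw [← sum_signature_smul M (tangentProj M x v)]
  rw [map_sum]
  refine Finset.sum_congr rfl fun i _ => ?_
  rw [map_smul, tangentProjLin_apply, tangentBasisVec, ← form_tangentProj_comm,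
    form_comm M (EuclideanSpace.single i 1)]

theorem sum_signature_mul_map {x X : Ambient n} (hX : IsTangent M x X)
    (T : Ambient n →ₗ[ℝ] ℝ) :
    ∑ i, signature M i * (form M X (tangentBasisVec M x i) * T (tangentBasisVec M x i)) = T X := by
  have h := congrArg T (sum_signature_smul_tangentBasisVec M x X)
  rw [tangentProj_of_isTangent M hX, tangentProj_of_isTangent M hX] at h
  rw [← h, map_sum]
  exact Finset.sum_congr rfl fun i _ => by rw [map_smul, smul_eq_mul, mul_assoc]

/-- Turns a metric trace into a coordinate trace, the form in which the Euclidean divergence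
appears, whatever the signature. The difference of the two is a multiple of `⟨T(u), x⟩`, where `u`
is the tangential projection of `x`, which is zero. -/
theorem sum_signature_form_tangentBasisVec {x : Ambient n} (hx : x ∈ points M n)
    (T : Ambient n →ₗ[ℝ] Ambient n) :
    ∑ i, signature M i * form M (T (tangentBasisVec M x i)) (tangentBasisVec M x i) =
      ∑ i, T (tangentBasisVec M x i) i := by
  have h0 : tangentProj M x x = 0 := by
    simp [tangentProj, form_self_of_mem M hx, sign_mul_sign]
  have h1 : ∑ i, (signature M i * form M (EuclideanSpace.single i 1) x) •
      tangentBasisVec M x i = 0 := by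
    have h := congrArg (tangentProjLin M x) (sum_signature_smul M x)
    rw [map_sum, tangentProjLin_apply, h0] at h
    rw [← h]
    exact Finset.sum_congr rfl fun i _ => by
      rw [map_smul, tangentProjLin_apply, tangentBasisVec]
  have h2 := congrArg (fun v => form M (T v) x) h1
  simp only [map_zero, form_zero_left] at h2
  rw [← formBilin_apply, map_sum, map_sum, LinearMap.sum_apply] at h2
  simp only [map_smul, LinearMap.smul_apply, smul_eq_mul, formBilin_apply] at h2
  have h3 : ∀ i, signature M i * form M (T (tangentBasisVec M x i)) (tangentBasisVec M x i) =
      T (tangentBasisVec M x i) i - M.sign * (signature M i *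
        form M (EuclideanSpace.single i 1) x * form M (T (tangentBasisVec M x i)) x) := fun i => by
    generalize T (tangentBasisVec M x i) = v
    rw [tangentBasisVec, tangentProj, form_sub_right, form_smul_right,
      form_comm M v (EuclideanSpace.single i 1), form_single, form_comm M x]
    linear_combination v i * signature_mul_self M i
  simp only [h3, Finset.sum_sub_distrib]
  rw [← Finset.mul_sum, h2]
  ring

theorem sum_signature_form_tangentBasisVec_self {x : Ambient n} (hx : x ∈ points M n) :
    ∑ i, signature M i * form M (tangentBasisVec M x i) (tangentBasisVec M x i) = n := by
  have h := sum_signature_form_tangentBasisVec M hx LinearMap.id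
  simp only [LinearMap.id_apply] at h
  rw [h]
  have h1 : ∀ i, tangentBasisVec M x i i = 1 - M.sign * (signature M i * x i * x i) := fun i => by
    rw [tangentBasisVec, tangentProj, form_comm, form_single]
    simp
    ring
  simp only [h1, Finset.sum_sub_distrib, ← Finset.mul_sum]
  change _ - M.sign * form M x x = _
  rw [form_self_of_mem M hx, sign_mul_sign]
  simp

theorem isTangent_tangentBasisVec {x : Ambient n} (hx : x ∈ points M n) (i : Fin (n + 1)) :
    IsTangent M x (tangentBasisVec M x i) :=
  isTangent_tangentProj M hx _

end Algebra

/-! ### Smoothness of the ambient form and derivatives along lines. -/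

section Calculus

variable (M : Kind) {n : ℕ}

theorem _root_.ContDiff.spaceForm_form {E : Type*} [NormedAddCommGroup E] [NormedSpace ℝ E]
    {k : WithTop ℕ∞} {f g : E → Ambient n} (hf : ContDiff ℝ k f) (hg : ContDiff ℝ k g) :
    ContDiff ℝ k fun x => form M (f x) (g x) := by
  unfold form
  refine ContDiff.sum fun i _ => ?_
  rw [contDiff_euclidean] at hf hg
  exact (contDiff_const.mul (hf i)).mul (hg i)

theorem _root_.Continuous.spaceForm_form {E : Type*} [TopologicalSpace E]
    {f g : E → Ambient n} (hf : Continuous f) (hg : Continuous g) :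
    Continuous fun x => form M (f x) (g x) := by
  unfold form
  fun_prop

theorem _root_.Continuous.spaceForm_tangentProj {E : Type*} [TopologicalSpace E]
    {f g : E → Ambient n} (hf : Continuous f) (hg : Continuous g) :
    Continuous fun x => tangentProj M (f x) (g x) := by
  unfold tangentProj
  exact hg.sub ((continuous_const.mul (hf.spaceForm_form M hg)).smul hf)

theorem _root_.HasDerivAt.spaceForm_form {f g : ℝ → Ambient n} {f' g' : Ambient n} {t : ℝ}
    (hf : HasDerivAt f f' t) (hg : HasDerivAt g g' t) :
    HasDerivAt (fun t => form M (f t) (g t)) (form M f' (g t) + form M (f t) g') t := by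
  unfold form
  rw [← Finset.sum_add_distrib]
  refine HasDerivAt.fun_sum fun i _ => ?_
  have h1 : HasDerivAt (fun t => f t i) (f' i) t :=
    ((EuclideanSpace.proj i : Ambient n →L[ℝ] ℝ).hasFDerivAt.comp_hasDerivAt t hf)
  have h2 : HasDerivAt (fun t => g t i) (g' i) t :=
    ((EuclideanSpace.proj i : Ambient n →L[ℝ] ℝ).hasFDerivAt.comp_hasDerivAt t hg)
  exact ((h1.const_mul (signature M i)).mul h2).congr_deriv (by ring)

theorem hasDerivAt_line {E F : Type*} [NormedAddCommGroup E] [NormedSpace ℝ E]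
    [NormedAddCommGroup F] [NormedSpace ℝ F] {f : E → F} {x : E} (hf : DifferentiableAt ℝ f x)
    (X : E) : HasDerivAt (fun t : ℝ => f (x + t • X)) (fderiv ℝ f x X) 0 :=
  hf.hasFDerivAt.hasLineDerivAt X

theorem fderiv_eq_of_hasDerivAt_line {E F : Type*} [NormedAddCommGroup E] [NormedSpace ℝ E]
    [NormedAddCommGroup F] [NormedSpace ℝ F] {f : E → F} {x X : E} {f' : F}
    (hf : DifferentiableAt ℝ f x) (h : HasDerivAt (fun t : ℝ => f (x + t • X)) f' 0) :
    fderiv ℝ f x X = f' :=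
  (hasDerivAt_line hf X).unique h

theorem hasDerivAt_add_smul {E : Type*} [NormedAddCommGroup E] [NormedSpace ℝ E] (x X : E)
    (t : ℝ) : HasDerivAt (fun t : ℝ => x + t • X) X t := by
  simpa using ((hasDerivAt_id t).smul_const X).const_add x

end Calculus

/-! ### The conformal gradient field: closed formula, norm, covariant derivative. -/

section ConformalGradient

variable (M : Kind) {n : ℕ} (a : Ambient n)

theorem conformalGradient_eq_tangentProj (x : Ambient n) :
    conformalGradient M a x = tangentProj M x (tangentProj M x a) := by
  rw [← sum_signature_smul_tangentBasisVec]
  unfold conformalGradient grad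
  have h : ∀ v, fderiv ℝ (fun x => form M a x) x v = form M a v := fun v => by
    have hd : DifferentiableAt ℝ (fun x => form M a x) x :=
      (ContDiff.spaceForm_form M contDiff_const contDiff_id : ContDiff ℝ 1 _).differentiable
        (by simp) x
    refine fderiv_eq_of_hasDerivAt_line hd ?_
    exact ((hasDerivAt_const (0 : ℝ) a).spaceForm_form M
      (hasDerivAt_add_smul x v 0)).congr_deriv (by simp [form_zero_left])
  simp only [h]

/-- Valid on all of `𝕍`, hence usable for differentiation: it shows that the field is polynomial in
`x`. On the space form the factor `⟨x, x⟩ - 2ε` is `-ε`. -/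
theorem conformalGradient_eq (x : Ambient n) :
    conformalGradient M a x =
      a + (form M a x * (form M x x - 2 * M.sign)) • x := by
  rw [conformalGradient_eq_tangentProj]
  simp only [tangentProj, form_sub_right, form_smul_right, form_comm M x a]
  rw [sub_sub, ← add_smul, sub_eq_add_neg, ← neg_smul]
  congr 2
  linear_combination (form M a x * form M x x) * sign_mul_sign M

theorem conformalGradient_of_mem {x : Ambient n} (hx : x ∈ points M n) :
    conformalGradient M a x = a - (M.sign * form M a x) • x := by
  rw [conformalGradient_eq, form_self_of_mem M hx, sub_eq_add_neg a, ← neg_smul]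
  congr 2
  ring

theorem isVectorField_conformalGradient : IsVectorField M (conformalGradient M a) where
  smooth := by
    have h : conformalGradient M a = fun x =>
      a + (form M a x * (form M x x - 2 * M.sign)) • x := funext (conformalGradient_eq M a)
    rw [h]
    exact contDiff_const.add (((ContDiff.spaceForm_form M contDiff_const contDiff_id).mul
      ((ContDiff.spaceForm_form M contDiff_id contDiff_id).sub contDiff_const)).smul contDiff_id)
  tangent x hx := isTangent_grad M hx _

theorem form_conformalGradient_of_isTangent {x X : Ambient n} (hx : x ∈ points M n)
    (hX : IsTangent M x X) : form M (conformalGradient M a x) X = form M a X := by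
  have h : form M x X = 0 := hX
  rw [conformalGradient_of_mem M a hx, form_sub_left, form_smul_left, h]
  ring

theorem form_conformalGradient_self {x : Ambient n} (hx : x ∈ points M n) :
    form M (conformalGradient M a x) (conformalGradient M a x) =
      form M a a - M.sign * form M a x ^ 2 := by
  rw [form_conformalGradient_of_isTangent M a hx
    ((isVectorField_conformalGradient M a).tangent x hx), conformalGradient_of_mem M a hx,
    form_sub_right, form_smul_right]
  ring

/-- The conformal gradient field is conformal (and closed): `∇_X σ = -ε α X`. -/
theorem covDeriv_conformalGradient {x X : Ambient n} (hx : x ∈ points M n)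
    (hX : IsTangent M x X) :
    covDeriv M (conformalGradient M a) x X = -(M.sign * form M a x) • X := by
  have h0 : form M x X = 0 := hX
  have h0' : form M X x = 0 := by rw [form_comm, h0]
  have h : fderiv ℝ (conformalGradient M a) x X =
      -(M.sign * form M a x) • X - (M.sign * form M a X) • x := by
    refine fderiv_eq_of_hasDerivAt_line
      ((isVectorField_conformalGradient M a).smooth.differentiable (by simp) x) ?_
    simp only [conformalGradient_eq]
    have hl := hasDerivAt_add_smul x X 0
    refine (((((hasDerivAt_const (0 : ℝ) a).spaceForm_form M hl).mul
      ((hl.spaceForm_form M hl).sub_const (2 * M.sign))).smul hl).const_add a).congr_deriv ?_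
    simp only [Pi.mul_apply, zero_smul, add_zero, form_zero_left, h0, h0', form_self_of_mem M hx,
      zero_add, mul_zero]
    rw [sub_eq_add_neg (_ • X), ← neg_smul]
    congr 2 <;> ring
  have h1 : tangentProj M x x = 0 := by
    simp [tangentProj, form_self_of_mem M hx, sign_mul_sign]
  rw [covDeriv, h, ← tangentProjLin_apply, map_sub, map_smul, map_smul, tangentProjLin_apply,
    tangentProjLin_apply, h1, tangentProj_of_isTangent M hX]
  simp

end ConformalGradient

/-! ### Polar coordinates on the open cone and the volume measure. -/

section Cone

open MeasureTheory

variable (M : Kind) {n : ℕ}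

/-- The radial coordinate `r` of the polar coordinates `v = r x` on the open cone. -/
def coneRadius (v : Ambient n) : ℝ := √(M.sign * form M v v)

/-- The radial projection of the open cone to the space form. -/
def coneProj (v : Ambient n) : Ambient n := (coneRadius M v)⁻¹ • v

theorem sign_mul_form_smul {x : Ambient n} (hx : x ∈ points M n) (t : ℝ) :
    M.sign * form M (t • x) (t • x) = t ^ 2 := by
  rw [form_smul_left, form_smul_right, form_self_of_mem M hx]
  linear_combination t ^ 2 * sign_mul_sign M

theorem coneRadius_smul {x : Ambient n} (hx : x ∈ points M n) {t : ℝ} (ht : 0 < t) :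
    coneRadius M (t • x) = t := by
  rw [coneRadius, sign_mul_form_smul M hx, Real.sqrt_sq ht.le]

theorem coneProj_smul {x : Ambient n} (hx : x ∈ points M n) {t : ℝ} (ht : 0 < t) :
    coneProj M (t • x) = x := by
  rw [coneProj, coneRadius_smul M hx ht, inv_smul_smul₀ ht.ne']

theorem coneRadius_pos {v : Ambient n} (hv : v ∈ openCone M n) : 0 < coneRadius M v := by
  obtain ⟨t, ht, x, hx, rfl⟩ := hv
  rwa [coneRadius_smul M hx ht]

theorem sign_mul_form_self_pos {v : Ambient n} (hv : v ∈ openCone M n) :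
    0 < M.sign * form M v v :=
  Real.sqrt_pos.1 (coneRadius_pos M hv)

theorem coneProj_mem {v : Ambient n} (hv : v ∈ openCone M n) : coneProj M v ∈ points M n := by
  obtain ⟨t, ht, x, hx, rfl⟩ := hv
  rwa [coneProj_smul M hx ht]

theorem coneRadius_smul_coneProj {v : Ambient n} (hv : v ∈ openCone M n) :
    coneRadius M v • coneProj M v = v :=
  smul_inv_smul₀ (coneRadius_pos M hv).ne' v

/-- The description by strict inequalities yields openness of the cone, and later places a timelike
pole or its negative inside it. -/
theorem mem_openCone_iff {v : Ambient n} :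
    v ∈ openCone M n ↔ 0 < M.sign * form M v v ∧ (M = .hyperbolic → 0 < v (Fin.last n)) := by
  constructor
  · refine fun hv => ⟨sign_mul_form_self_pos M hv, fun hM => ?_⟩
    obtain ⟨t, ht, x, hx, rfl⟩ := hv
    subst hM
    simpa using mul_pos ht hx.2
  · rintro ⟨h1, h2⟩
    have hr : 0 < √(M.sign * form M v v) := Real.sqrt_pos.2 h1
    have hs : √(M.sign * form M v v) * √(M.sign * form M v v) = M.sign * form M v v :=
      Real.mul_self_sqrt h1.le
    refine ⟨_, hr, (√(M.sign * form M v v))⁻¹ • v, ?_, (smul_inv_smul₀ hr.ne' v).symm⟩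
    generalize √(M.sign * form M v v) = r at hr hs
    have hf : form M (r⁻¹ • v) (r⁻¹ • v) = M.sign := by
      rw [form_smul_left, form_smul_right]
      field_simp
      rw [pow_two, hs]
      linear_combination (-form M v v) * sign_mul_sign M
    cases M
    · exact hf
    · exact ⟨hf, by simpa using mul_pos (inv_pos.2 hr) (h2 rfl)⟩

theorem continuous_form_self : Continuous fun v : Ambient n => form M v v :=
  continuous_id.spaceForm_form M continuous_id

theorem isOpen_openCone : IsOpen (openCone M n) := by
  have h : openCone M n = {v | 0 < M.sign * form M v v} ∩
      {v | M = .hyperbolic → 0 < v (Fin.last n)} := Set.ext fun v => mem_openCone_iff M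
  rw [h]
  refine (isOpen_lt continuous_const (continuous_const.mul (continuous_form_self M))).inter ?_
  by_cases hM : M = .hyperbolic
  · simp only [hM, forall_true_left]
    exact isOpen_lt continuous_const (by fun_prop)
  · simp [hM]

theorem isClosed_points : IsClosed (points M n) := by
  cases M
  · exact isClosed_eq (continuous_form_self _) continuous_const
  -- The condition `xₙ₊₁ > 0` may be weakened to `≥ 0`: with `xₙ₊₁ = 0` the form would be a sum of
  -- squares, not `-1`.
  · have h : points .hyperbolic n = {x : Ambient n | form .hyperbolic x x = -1} ∩
        {x : Ambient n | 0 ≤ x (Fin.last n)} := by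
      ext x
      refine ⟨fun hx => ⟨hx.1, hx.2.le⟩, fun hx => ⟨hx.1, lt_of_le_of_ne hx.2 fun h0 => ?_⟩⟩
      have h1 : form .hyperbolic x x = -1 := hx.1
      rw [form_eq_sum_castSucc, ← h0] at h1
      have : 0 ≤ ∑ i : Fin n, x i.castSucc * x i.castSucc :=
        Finset.sum_nonneg fun i _ => mul_self_nonneg _
      linarith
    rw [h]
    exact (isClosed_eq (continuous_form_self _) continuous_const).inter
      (isClosed_le continuous_const (by fun_prop))

theorem continuous_coneRadius : Continuous (coneRadius M (n := n)) :=
  (continuous_const.mul (continuous_form_self M)).sqrt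

theorem measurable_coneProj : Measurable (coneProj M (n := n)) :=
  (continuous_coneRadius M).measurable.inv.smul measurable_id

theorem continuousOn_coneProj : ContinuousOn (coneProj M (n := n)) (openCone M n) :=
  ((continuous_coneRadius M).continuousOn.inv₀ fun _ hv => (coneRadius_pos M hv).ne').smul
    continuousOn_id

/-- The part of the open cone inside the space form. -/
def openConeBelow (n : ℕ) : Set (Ambient n) := openCone M n ∩ {v | M.sign * form M v v < 1}

theorem isOpen_openConeBelow : IsOpen (openConeBelow M n) :=
  (isOpen_openCone M).inter
    (isOpen_lt (continuous_const.mul (continuous_form_self M)) continuous_const)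

theorem coneRadius_lt_one {v : Ambient n} (hv : v ∈ openConeBelow M n) : coneRadius M v < 1 := by
  rw [coneRadius, Real.sqrt_lt' one_pos, one_pow]
  exact hv.2

theorem volumeMeasure_eq (n : ℕ) : volumeMeasure M n =
    ((n : ENNReal) + 1) • (volume.restrict (openConeBelow M n)).map (coneProj M) := rfl

theorem volumeMeasure_apply {s : Set (Ambient n)} (hs : MeasurableSet s) :
    volumeMeasure M n s =
      ((n : ENNReal) + 1) * volume (coneProj M ⁻¹' s ∩ openConeBelow M n) := by
  rw [volumeMeasure_eq, Measure.smul_apply, Measure.map_apply (measurable_coneProj M) hs,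
    Measure.restrict_apply (measurable_coneProj M hs), smul_eq_mul]

theorem volumeMeasure_compl_points : volumeMeasure M n (points M n)ᶜ = 0 := by
  rw [volumeMeasure_apply M (isClosed_points M).measurableSet.compl]
  have : coneProj M ⁻¹' (points M n)ᶜ ∩ openConeBelow M n = ∅ := by
    ext v
    simp only [Set.mem_inter_iff, Set.mem_preimage, Set.mem_compl_iff, Set.mem_empty_iff_false,
      iff_false, not_and]
    exact fun h hv => h (coneProj_mem M hv.1)
  rw [this, measure_empty, mul_zero]

theorem ae_mem_points : ∀ᵐ x ∂volumeMeasure M n, x ∈ points M n :=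
  volumeMeasure_compl_points M

/-- If `K` lies in the ball of radius `R`, so does the truncated cone over it, because its points
are `r x` with `r < 1`. -/
instance : IsFiniteMeasureOnCompacts (volumeMeasure M n) where
  lt_top_of_isCompact K hK := by
    rw [volumeMeasure_apply M hK.measurableSet]
    refine ENNReal.mul_lt_top (by finiteness) ?_
    obtain ⟨R, hR⟩ := hK.isBounded.subset_closedBall (0 : Ambient n)
    refine (measure_mono ?_).trans_lt (measure_closedBall_lt_top (x := (0 : Ambient n)) (r := R))
    rintro v ⟨hvK, hv⟩
    have h1 := hR hvK
    rw [mem_closedBall_zero_iff] at h1 ⊢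
    rw [← coneRadius_smul_coneProj M hv.1, norm_smul, Real.norm_of_nonneg
      (coneRadius_pos M hv.1).le]
    nlinarith [coneRadius_lt_one M hv, norm_nonneg (coneProj M v)]

theorem integral_volumeMeasure {f : Ambient n → ℝ}
    (hf : AEStronglyMeasurable f (volumeMeasure M n)) :
    ∫ x, f x ∂volumeMeasure M n = ((n : ℝ) + 1) * ∫ v in openConeBelow M n, f (coneProj M v) := by
  have hc : ((n : ENNReal) + 1) ≠ 0 := by simp
  rw [volumeMeasure_eq] at hf ⊢
  rw [integral_smul_measure, integral_map (measurable_coneProj M).aemeasurable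
    (hf.mono_ac (Measure.absolutelyContinuous_smul hc))]
  simp [ENNReal.toReal_add]

theorem integrable_comp_coneProj {f : Ambient n → ℝ} (hf : Integrable f (volumeMeasure M n)) :
    IntegrableOn (fun v => f (coneProj M v)) (openConeBelow M n) := by
  rw [volumeMeasure_eq, integrable_smul_measure (by simp) (by finiteness)] at hf
  exact hf.comp_measurable (measurable_coneProj M)

/-- Continuity is required only along the space form: elsewhere `1 + |σ|²` need not be positive and
its real powers need not be continuous. -/
theorem integrable_of_continuousOn_points {f : Ambient n → ℝ} {K : Set (Ambient n)}
    (hf : ContinuousOn f (points M n)) (hK : IsCompact K) (h0 : ∀ x ∉ K, f x = 0) :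
    Integrable f (volumeMeasure M n) := by
  have hKM : IsCompact (K ∩ points M n) := hK.inter_right (isClosed_points M)
  have h1 : IntegrableOn f (K ∩ points M n) (volumeMeasure M n) :=
    (hf.mono Set.inter_subset_right).integrableOn_compact hKM
  refine ((integrable_indicator_iff hKM.measurableSet).2 h1).congr ?_
  filter_upwards [ae_mem_points M] with x hx
  by_cases hxK : x ∈ K
  · rw [Set.indicator_of_mem (show x ∈ K ∩ points M n from ⟨hxK, hx⟩)]
  · rw [Set.indicator_of_notMem (fun h : x ∈ K ∩ points M n => hxK h.1), h0 x hxK]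

/-- Nonempty relatively open subsets of the space form have positive volume. -/
theorem volumeMeasure_pos {U : Set (Ambient n)} (hU : IsOpen U) {x : Ambient n}
    (hx : x ∈ points M n) (hxU : x ∈ U) : 0 < volumeMeasure M n U := by
  rw [volumeMeasure_apply M hU.measurableSet]
  have ho : IsOpen (coneProj M ⁻¹' U ∩ openConeBelow M n) := by
    rw [Set.inter_comm]
    exact ((continuousOn_coneProj M).mono Set.inter_subset_left).isOpen_inter_preimage
      (isOpen_openConeBelow M) hU
  -- Any `t x` with `0 < t < 1` would do; nonemptiness makes the open truncated cone over `U` of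
  -- positive Lebesgue measure.
  have hm : (1 / 2 : ℝ) • x ∈ coneProj M ⁻¹' U ∩ openConeBelow M n := by
    refine ⟨?_, ⟨1 / 2, by norm_num, x, hx, rfl⟩, ?_⟩
    · rwa [Set.mem_preimage, coneProj_smul M hx (by norm_num)]
    · rw [Set.mem_ofPred_eq, sign_mul_form_smul M hx]
      norm_num
  exact ENNReal.mul_pos (by simp) (ho.measure_pos volume ⟨_, hm⟩).ne'

end Cone

/-! ### The divergence theorem on the space form. -/

section Divergence

open MeasureTheory Filter Topology

variable (M : Kind) {n : ℕ}

/-- The divergence of a tangent vector field: the metric trace of its covariant derivative. -/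
def surfaceDiv (Z : Ambient n → Ambient n) (x : Ambient n) : ℝ :=
  ∑ i, signature M i * form M (fderiv ℝ Z x (tangentBasisVec M x i)) (tangentBasisVec M x i)

theorem surfaceDiv_eq_sum {x : Ambient n} (hx : x ∈ points M n) (Z : Ambient n → Ambient n) :
    surfaceDiv M Z x = ∑ i, fderiv ℝ Z x (tangentBasisVec M x i) i :=
  sum_signature_form_tangentBasisVec M hx (fderiv ℝ Z x).toLinearMap

theorem contDiffAt_coneRadius {v : Ambient n} (hv : v ∈ openCone M n) :
    ContDiffAt ℝ 1 (coneRadius M) v :=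
  (contDiff_const.mul (contDiff_id.spaceForm_form M contDiff_id)).contDiffAt.sqrt
    (sign_mul_form_self_pos M hv).ne'

theorem contDiffAt_coneProj {v : Ambient n} (hv : v ∈ openCone M n) :
    ContDiffAt ℝ 1 (coneProj M) v :=
  ((contDiffAt_coneRadius M hv).inv (coneRadius_pos M hv).ne').smul contDiffAt_id

theorem hasDerivAt_coneRadius_line {v : Ambient n} (hv : v ∈ openCone M n) (X : Ambient n) :
    HasDerivAt (fun t : ℝ => coneRadius M (v + t • X)) (M.sign * form M (coneProj M v) X) 0 := by
  have hl := hasDerivAt_add_smul v X 0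
  have hr := coneRadius_pos M hv
  refine (((hl.spaceForm_form M hl).const_mul M.sign).sqrt
    (by simpa using (sign_mul_form_self_pos M hv).ne')).congr_deriv ?_
  simp only [zero_smul, add_zero]
  change _ / (2 * coneRadius M v) = _
  rw [coneProj, form_smul_left, form_comm M X v]
  field_simp
  ring

theorem hasDerivAt_coneProj_line {v : Ambient n} (hv : v ∈ openCone M n) (X : Ambient n) :
    HasDerivAt (fun t : ℝ => coneProj M (v + t • X))
      ((coneRadius M v)⁻¹ • tangentProj M (coneProj M v) X) 0 := by
  have hr := coneRadius_pos M hv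
  have h := ((hasDerivAt_coneRadius_line M hv X).fun_inv (by simpa using hr.ne')).smul
    (hasDerivAt_add_smul v X 0)
  refine h.congr_deriv ?_
  simp only [zero_smul, add_zero, tangentProj, smul_sub]
  conv_lhs => enter [2, 2]; rw [← coneRadius_smul_coneProj M hv]
  rw [sub_eq_add_neg (_ • X), smul_smul, smul_smul, ← neg_smul]
  congr 2
  field_simp

/-- Integration by parts against the constant function `1`. -/
theorem integral_fderiv_apply_eq_zero {E : Type*} [NormedAddCommGroup E] [NormedSpace ℝ E]
    [FiniteDimensional ℝ E] [MeasurableSpace E] [BorelSpace E] (ν : Measure E) [ν.IsAddHaarMeasure]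
    {f : E → ℝ} (hf : ContDiff ℝ 1 f) (hc : HasCompactSupport f) (X : E) :
    ∫ v, fderiv ℝ f v X ∂ν = 0 := by
  have hi : Integrable (fun v => fderiv ℝ f v X) ν :=
    ((hf.continuous_fderiv (by simp)).clm_apply continuous_const).integrable_of_hasCompactSupport
      (hc.fderiv_apply (𝕜 := ℝ) X)
  have h := integral_mul_fderiv_eq_neg_fderiv_mul_of_integrable (μ := ν) (f := f)
    (g := fun _ => (1 : ℝ)) (v := X) (by simpa using hi) (by simp)
    (by simpa using hf.continuous.integrable_of_hasCompactSupport hc)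
    (fun x _ => hf.differentiable (by simp) x) (fun x _ => differentiableAt_const _)
  simpa using h

/-- A radially cut off homogeneous extension of a vector field of the space form. -/
def radialExtension (κ : ℝ → ℝ) (Z : Ambient n → Ambient n) : Ambient n → Ambient n :=
  (openCone M n).indicator fun v => (coneRadius M v * κ (coneRadius M v)) • Z (coneProj M v)

theorem radialExtension_eventuallyEq (κ : ℝ → ℝ) (Z : Ambient n → Ambient n) {v : Ambient n}
    (hv : v ∈ openCone M n) : radialExtension M κ Z =ᶠ[𝓝 v]
      fun v => (coneRadius M v * κ (coneRadius M v)) • Z (coneProj M v) :=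
  Set.eqOn_indicator.eventuallyEq_of_mem ((isOpen_openCone M).mem_nhds hv)

/-- The factor `r` in the extension cancels the `1/r` from differentiating the radial projection.
The derivative of the radial factor contributes a multiple of `⟨x, Z⟩`, which vanishes by tangency,
so `κ'` drops out. -/
theorem sum_fderiv_radialExtension {κ : ℝ → ℝ} (hκ : ContDiff ℝ 1 κ) {Z : Ambient n → Ambient n}
    {v : Ambient n} (hv : v ∈ openCone M n) (hZ : DifferentiableAt ℝ Z (coneProj M v))
    (hT : IsTangent M (coneProj M v) (Z (coneProj M v)))
    (hd : DifferentiableAt ℝ (radialExtension M κ Z) v) :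
    ∑ i, fderiv ℝ (radialExtension M κ Z) v (EuclideanSpace.single i 1) i =
      κ (coneRadius M v) * surfaceDiv M Z (coneProj M v) := by
  have hr := coneRadius_pos M hv
  set r := coneRadius M v with hrdef
  set x := coneProj M v with hxdef
  have h : ∀ X, fderiv ℝ (radialExtension M κ Z) v X =
      κ r • fderiv ℝ Z x (tangentProj M x X) +
        ((κ r + r * deriv κ r) * (M.sign * form M x X)) • Z x := fun X => by
    refine fderiv_eq_of_hasDerivAt_line hd ?_
    have hl : Tendsto (fun t : ℝ => v + t • X) (𝓝 0) (𝓝 v) := by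
      have := (hasDerivAt_add_smul v X 0).continuousAt.tendsto
      simpa using this
    refine HasDerivAt.congr_of_eventuallyEq ?_
      (hl.eventually (radialExtension_eventuallyEq M κ Z hv))
    have h1 := hasDerivAt_coneRadius_line M hv X
    have h2 : HasDerivAt (fun t : ℝ => κ (coneRadius M (v + t • X)))
        (deriv κ r * (M.sign * form M x X)) 0 :=
      HasDerivAt.comp (0 : ℝ) (by
        rw [zero_smul, add_zero]
        exact (hκ.differentiable (by simp) r).hasDerivAt) h1
    have h3 : HasDerivAt (fun t : ℝ => Z (coneProj M (v + t • X)))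
        (fderiv ℝ Z x (r⁻¹ • tangentProj M x X)) 0 :=
      HasFDerivAt.comp_hasDerivAt (0 : ℝ) (by simpa using hZ.hasFDerivAt)
        (hasDerivAt_coneProj_line M hv X)
    refine ((h1.mul h2).smul h3).congr_deriv ?_
    simp only [Pi.mul_apply, zero_smul, add_zero, map_smul, smul_smul]
    congr 2
    · rw [← hrdef]
      field_simp
    · rw [← hrdef, ← hxdef]
      ring
  have hT' : ∑ i, form M x (EuclideanSpace.single i 1) * Z x i = 0 := by
    have : form M x (Z x) = 0 := hT
    rw [← this, form]
    exact Finset.sum_congr rfl fun i _ => by rw [form_comm, form_single]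
  rw [surfaceDiv_eq_sum M (coneProj_mem M hv), Finset.mul_sum]
  simp only [h, PiLp.add_apply, PiLp.smul_apply, smul_eq_mul, Finset.sum_add_distrib]
  have h4 : ∑ i, (κ r + r * deriv κ r) * (M.sign * form M x (EuclideanSpace.single i 1)) * Z x i =
      (κ r + r * deriv κ r) * M.sign * ∑ i, form M x (EuclideanSpace.single i 1) * Z x i := by
    rw [Finset.mul_sum]
    exact Finset.sum_congr rfl fun i _ => by ring
  rw [h4, hT', mul_zero, add_zero]
  rfl

/-- The extension is a compactly supported `C¹` field on `𝕍`, so its Euclidean divergence has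
integral zero. The cut-off keeps the support away from the vertex and the boundary of the cone. -/
theorem integral_radial_surfaceDiv {κ : ℝ → ℝ} (hκ : ContDiff ℝ 1 κ) {δ : ℝ} (hδ : 0 < δ)
    (h0 : ∀ r ≤ δ, κ r = 0) (h1 : ∀ r, 1 ≤ r → κ r = 0) {Z : Ambient n → Ambient n}
    {K : Set (Ambient n)} (hK : IsCompact K) (hZ0 : ∀ x ∉ K, Z x = 0)
    (hZ : ∀ x ∈ points M n, ContDiffAt ℝ 1 Z x) (hT : ∀ x ∈ points M n, IsTangent M x (Z x)) :
    ∫ v in openConeBelow M n, κ (coneRadius M v) * surfaceDiv M Z (coneProj M v) = 0 := by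
  set G := radialExtension M κ Z with hG
  -- Compact and inside the open cone, so extending by zero across the boundary of the cone creates
  -- no singularity.
  set C := (fun p : ℝ × Ambient n => p.1 • p.2) '' (Set.Icc δ 1 ×ˢ (K ∩ points M n)) with hCdef
  have hC : IsCompact C :=
    (isCompact_Icc.prod (hK.inter_right (isClosed_points M))).image (by fun_prop)
  have hCc : C ⊆ openCone M n := by
    rintro _ ⟨⟨t, x⟩, ⟨ht, hx⟩, rfl⟩
    exact ⟨t, hδ.trans_le ht.1, x, hx.2, rfl⟩
  have hGC : ∀ v ∉ C, G v = 0 := fun v hv => by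
    by_cases hvc : v ∈ openCone M n
    · rw [hG, radialExtension, Set.indicator_of_mem hvc]
      by_cases hr : coneRadius M v ≤ δ
      · rw [h0 _ hr, mul_zero, zero_smul]
      by_cases hr1 : 1 ≤ coneRadius M v
      · rw [h1 _ hr1, mul_zero, zero_smul]
      rw [hZ0 _ fun hvK => hv ⟨(coneRadius M v, coneProj M v), ⟨⟨(not_le.1 hr).le,
        (not_le.1 hr1).le⟩, hvK, coneProj_mem M hvc⟩, coneRadius_smul_coneProj M hvc⟩, smul_zero]
    · exact Set.indicator_of_notMem hvc _
  have hGe : ∀ v ∉ openCone M n, G =ᶠ[𝓝 v] fun _ => 0 := fun v hv => by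
    filter_upwards [hC.isClosed.isOpen_compl.mem_nhds fun h => hv (hCc h)] with w hw
    exact hGC w hw
  have hGd : ContDiff ℝ 1 G := by
    refine contDiff_iff_contDiffAt.2 fun v => ?_
    by_cases hv : v ∈ openCone M n
    · refine ContDiffAt.congr_of_eventuallyEq ?_ (radialExtension_eventuallyEq M κ Z hv)
      have hr := contDiffAt_coneRadius M hv
      exact (hr.mul (hκ.contDiffAt.comp v hr)).smul
        ((hZ _ (coneProj_mem M hv)).comp v (contDiffAt_coneProj M hv))
    · exact contDiffAt_const.congr_of_eventuallyEq (hGe v hv)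
  have hGi : ∀ i, ContDiff ℝ 1 fun v => G v i := contDiff_euclidean.1 hGd
  have hGs : ∀ i, HasCompactSupport fun v => G v i := fun i =>
    HasCompactSupport.intro hC fun v hv => by rw [hGC v hv]; rfl
  have hfd : ∀ i v X, fderiv ℝ (fun v => G v i) v X = fderiv ℝ G v X i := fun i v X => by
    refine fderiv_eq_of_hasDerivAt_line ((hGi i).differentiable (by simp) v) ?_
    exact (EuclideanSpace.proj i : Ambient n →L[ℝ] ℝ).hasFDerivAt.comp_hasDerivAt 0
      (hasDerivAt_line (hGd.differentiable (by simp) v) X)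
  have hsum : ∫ v, ∑ i, fderiv ℝ G v (EuclideanSpace.single i 1) i = 0 := by
    simp only [← hfd]
    rw [integral_finsetSum]
    · exact Finset.sum_eq_zero fun i _ => integral_fderiv_apply_eq_zero volume (hGi i) (hGs i) _
    · exact fun i _ => (((hGi i).continuous_fderiv (by simp)).clm_apply
        continuous_const).integrable_of_hasCompactSupport ((hGs i).fderiv_apply (𝕜 := ℝ) _)
  rw [← hsum, ← integral_indicator (isOpen_openConeBelow M).measurableSet]
  congr 1
  ext v
  by_cases hv : v ∈ openCone M n
  · rw [hG, sum_fderiv_radialExtension M hκ hv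
      ((hZ _ (coneProj_mem M hv)).differentiableAt (by simp)) (hT _ (coneProj_mem M hv))
      (hGd.differentiable (by simp) v)]
    by_cases hv1 : v ∈ openConeBelow M n
    · rw [Set.indicator_of_mem hv1]
    · rw [Set.indicator_of_notMem hv1, h1, zero_mul]
      rw [coneRadius, Real.one_le_sqrt]
      exact not_lt.1 fun h => hv1 ⟨hv, h⟩
  · rw [Set.indicator_of_notMem fun h => hv h.1, (hGe v hv).fderiv_eq]
    simp

theorem continuous_tangentBasisVec (i : Fin (n + 1)) :
    Continuous fun x : Ambient n => tangentBasisVec M x i :=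
  continuous_id.spaceForm_tangentProj M continuous_const

theorem continuousAt_surfaceDiv {Z : Ambient n → Ambient n} {x : Ambient n}
    (hZ : ContDiffAt ℝ 1 Z x) : ContinuousAt (surfaceDiv M Z) x := by
  have h1 : ContinuousAt (fderiv ℝ Z) x := (hZ.fderiv_right (m := 0) (by simp)).continuousAt
  have hf : Continuous fun p : Ambient n × Ambient n => form M p.1 p.2 :=
    continuous_fst.spaceForm_form M continuous_snd
  refine tendsto_finsetSum _ fun i _ => ContinuousAt.mul continuousAt_const ?_
  have hb := (continuous_tangentBasisVec M i).continuousAt (x := x)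
  exact hf.continuousAt.comp ((h1.clm_apply hb).prodMk hb)

theorem surfaceDiv_eq_zero {Z : Ambient n → Ambient n} {K : Set (Ambient n)} (hK : IsClosed K)
    (hZ0 : ∀ x ∉ K, Z x = 0) {x : Ambient n} (hx : x ∉ K) : surfaceDiv M Z x = 0 := by
  have : Z =ᶠ[𝓝 x] fun _ => 0 := by
    filter_upwards [hK.isOpen_compl.mem_nhds hx] with y hy using hZ0 y hy
  simp [surfaceDiv, this.fderiv_eq, form_zero_left]

/-- The divergence theorem for compactly supported vector fields of the space form. -/
theorem integral_surfaceDiv_eq_zero {Z : Ambient n → Ambient n} {K : Set (Ambient n)}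
    (hK : IsCompact K) (hZ0 : ∀ x ∉ K, Z x = 0) (hZ : ∀ x ∈ points M n, ContDiffAt ℝ 1 Z x)
    (hT : ∀ x ∈ points M n, IsTangent M x (Z x)) :
    Integrable (surfaceDiv M Z) (volumeMeasure M n) ∧
      ∫ x, surfaceDiv M Z x ∂volumeMeasure M n = 0 := by
  have hint : Integrable (surfaceDiv M Z) (volumeMeasure M n) := by
    exact integrable_of_continuousOn_points M
      (fun x hx => (continuousAt_surfaceDiv M (hZ x hx)).continuousWithinAt) hK
      fun x hx => surfaceDiv_eq_zero M hK.isClosed hZ0 hx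
  refine ⟨hint, ?_⟩
  rw [integral_volumeMeasure M hint.1]
  -- `κ j` vanishes for `r ≤ 1/(j+1)` and for `r ≥ 1`; it equals `1` once `(j+1) r ≥ 2` and `(j+1)(1
  -- - r) ≥ 1`. Thus `κ j → 1` pointwise on `0 < r < 1`, and dominated convergence removes the
  -- cut-off.
  let κ : ℕ → ℝ → ℝ := fun j r =>
    Real.smoothTransition (((j : ℝ) + 1) * r - 1) * Real.smoothTransition ((j + 1) * (1 - r))
  have hκ : ∀ j, ContDiff ℝ 1 (κ j) := fun j =>
    (Real.smoothTransition.contDiff.comp ((contDiff_const.mul contDiff_id).sub contDiff_const)).mul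
      (Real.smoothTransition.contDiff.comp (contDiff_const.mul (contDiff_const.sub contDiff_id)))
  have hz : ∀ j, ∫ v in openConeBelow M n,
      κ j (coneRadius M v) * surfaceDiv M Z (coneProj M v) = 0 := fun j => by
    have hj : (0 : ℝ) < (j : ℝ) + 1 := by positivity
    refine integral_radial_surfaceDiv M (hκ j) (δ := 1 / ((j : ℝ) + 1)) (by positivity)
      (fun r hr => ?_) (fun r hr => ?_) hK hZ0 hZ hT
    · rw [le_div_iff₀ hj] at hr
      simp only [κ]
      rw [Real.smoothTransition.zero_of_nonpos (by linarith), zero_mul]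
    · simp only [κ]
      rw [Real.smoothTransition.zero_of_nonpos (x := _ * (1 - r)) (by nlinarith), mul_zero]
  have hlim : Tendsto (fun j => ∫ v in openConeBelow M n,
      κ j (coneRadius M v) * surfaceDiv M Z (coneProj M v)) atTop
      (𝓝 (∫ v in openConeBelow M n, surfaceDiv M Z (coneProj M v))) := by
    have hi := integrable_comp_coneProj M hint
    refine tendsto_integral_of_dominated_convergence
      (fun v => ‖surfaceDiv M Z (coneProj M v)‖) (fun j => ?_) hi.norm (fun j => ?_) ?_
    · exact ((hκ j).continuous.comp (continuous_coneRadius M)).aestronglyMeasurable.mul hi.1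
    · refine .of_forall fun v => ?_
      rw [norm_mul]
      refine mul_le_of_le_one_left (norm_nonneg _) ?_
      rw [Real.norm_of_nonneg (mul_nonneg (Real.smoothTransition.nonneg _)
        (Real.smoothTransition.nonneg _))]
      exact mul_le_one₀ (Real.smoothTransition.le_one _) (Real.smoothTransition.nonneg _)
        (Real.smoothTransition.le_one _)
    · filter_upwards [ae_restrict_mem (isOpen_openConeBelow M).measurableSet] with v hv
      have hr := coneRadius_pos M hv.1
      have hr1 := coneRadius_lt_one M hv
      obtain ⟨N, hN⟩ := exists_nat_gt (max (2 / coneRadius M v) (1 / (1 - coneRadius M v)))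
      refine tendsto_const_nhds.congr' ?_
      filter_upwards [eventually_ge_atTop N] with j hj
      have hNj : (N : ℝ) ≤ j := by exact_mod_cast hj
      have ha : 2 / coneRadius M v < j := (le_max_left _ _).trans_lt (hN.trans_le hNj)
      have hb : 1 / (1 - coneRadius M v) < j := (le_max_right _ _).trans_lt (hN.trans_le hNj)
      rw [div_lt_iff₀ hr] at ha
      rw [div_lt_iff₀ (by linarith)] at hb
      simp only [κ]
      rw [Real.smoothTransition.one_of_one_le (by nlinarith),
        Real.smoothTransition.one_of_one_le (by nlinarith), one_mul, one_mul]
  simp only [hz] at hlim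
  rw [← tendsto_nhds_unique tendsto_const_nhds hlim, mul_zero]

end Divergence

/-! ### First variation of the vertical energy for an arbitrary vector field. -/

section FirstVariation

open MeasureTheory Filter Topology

/-- Joint continuity bounds `f'` on the compact set `closedBall t₀ 1 × S`, and this constant is the
dominating function. -/
theorem hasDerivAt_setIntegral_of_continuousOn {E : Type*} [TopologicalSpace E]
    [SecondCountableTopology E] [MeasurableSpace E] [OpensMeasurableSpace E]
    {ν : Measure E} {S : Set E} (hS : IsCompact S)
    (hSm : MeasurableSet S) (hν : ν S < ⊤) {f f' : ℝ → E → ℝ} (hf : ∀ t, ContinuousOn (f t) S)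
    (hf' : ContinuousOn (fun z : ℝ × E => f' z.1 z.2) (Set.univ ×ˢ S))
    (hd : ∀ t, ∀ x ∈ S, HasDerivAt (fun t => f t x) (f' t x) t) (t₀ : ℝ) :
    HasDerivAt (fun t => ∫ x in S, f t x ∂ν) (∫ x in S, f' t₀ x ∂ν) t₀ := by
  have hfin : IsFiniteMeasure (ν.restrict S) := ⟨by rwa [Measure.restrict_apply_univ]⟩
  have hint : ∀ g : E → ℝ, ContinuousOn g S → Integrable g (ν.restrict S) := fun g hg => by
    obtain ⟨C, hC⟩ := hS.exists_bound_of_continuousOn hg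
    exact Integrable.of_bound (hg.aestronglyMeasurable hSm) C
      ((ae_restrict_mem hSm).mono fun x hx => hC x hx)
  obtain ⟨C, hC⟩ := ((isCompact_closedBall t₀ 1).prod hS).exists_bound_of_continuousOn
    (hf'.mono (Set.prod_mono (Set.subset_univ _) subset_rfl))
  have hf0 : ContinuousOn (f' t₀) S :=
    hf'.comp (Continuous.prodMk_right t₀).continuousOn fun x hx => ⟨Set.mem_univ _, hx⟩
  refine (hasDerivAt_integral_of_dominated_loc_of_deriv_le (bound := fun _ => C)
    (Metric.closedBall_mem_nhds t₀ one_pos) (.of_forall fun t => (hint _ (hf t)).1)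
    (hint _ (hf t₀)) (hint _ hf0).1 ?_ (integrable_const C) ?_).2
  · exact (ae_restrict_mem hSm).mono fun x hx t ht => hC (t, x) ⟨ht, hx⟩
  · exact (ae_restrict_mem hSm).mono fun x hx t _ => hd t x hx

variable (M : Kind) {n : ℕ}

/-- The covariant derivative of `Y` in the direction of the `i`-th tangential basis vector. -/
def covBasis (Y : Ambient n → Ambient n) (i : Fin (n + 1)) (x : Ambient n) : Ambient n :=
  covDeriv M Y x (tangentBasisVec M x i)

theorem continuous_covBasis {Y : Ambient n → Ambient n} (hY : ContDiff ℝ 1 Y) (i : Fin (n + 1)) :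
    Continuous (covBasis M Y i) :=
  continuous_id.spaceForm_tangentProj M
    ((hY.continuous_fderiv (by simp)).clm_apply (continuous_tangentBasisVec M i))

theorem covBasis_add_smul {σ φ : Ambient n → Ambient n} (hσ : Differentiable ℝ σ)
    (hφ : Differentiable ℝ φ) (t : ℝ) (i : Fin (n + 1)) (x : Ambient n) :
    covBasis M (fun x => σ x + t • φ x) i x = covBasis M σ i x + t • covBasis M φ i x := by
  have h : fderiv ℝ (fun x => σ x + t • φ x) x = fderiv ℝ σ x + t • fderiv ℝ φ x :=
    ((hσ x).hasFDerivAt.add ((hφ x).hasFDerivAt.const_smul t)).fderiv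
  simp only [covBasis, covDeriv, h, ← tangentProjLin_apply]
  simp

theorem verticalEnergyDensity_eq (p q : ℝ) {x : Ambient n} (hx : x ∈ points M n)
    (Y : Ambient n → Ambient n) :
    verticalEnergyDensity M p q Y x = (1 / 2) * ((1 + form M (Y x) (Y x)) ^ (-p) *
      ∑ i, signature M i * (form M (covBasis M Y i x) (covBasis M Y i x) +
        q * form M (covBasis M Y i x) (Y x) ^ 2)) := by
  have hL : ∀ X, connectionMap M x (verticalDifferential M Y x X) = covDeriv M Y x X := fun X =>
    tangentProj_of_isTangent M (isTangent_tangentProj M hx _)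
  simp only [verticalEnergyDensity, metricTrace, cheegerGromoll, hL]
  congr 1
  rw [Finset.mul_sum]
  refine Finset.sum_congr rfl fun i _ => ?_
  simp only [verticalDifferential, form_zero_left, covBasis]
  ring

/-- The derivative of the energy density of `Y` in the direction of `φ`. -/
def densityVariation (p q : ℝ) (Y φ : Ambient n → Ambient n) (x : Ambient n) : ℝ :=
  (1 / 2) * (2 * form M (φ x) (Y x) * (-p) * (1 + form M (Y x) (Y x)) ^ (-p - 1) *
      (∑ i, signature M i * (form M (covBasis M Y i x) (covBasis M Y i x) +
        q * form M (covBasis M Y i x) (Y x) ^ 2)) +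
    (1 + form M (Y x) (Y x)) ^ (-p) *
      ∑ i, signature M i * (2 * form M (covBasis M Y i x) (covBasis M φ i x) +
        2 * q * form M (covBasis M Y i x) (Y x) *
          (form M (covBasis M φ i x) (Y x) + form M (covBasis M Y i x) (φ x))))

variable {M}

theorem one_add_form_self_pos {Y : Ambient n → Ambient n} (hY : IsVectorField M Y) {x : Ambient n}
    (hx : x ∈ points M n) : 0 < 1 + form M (Y x) (Y x) := by
  linarith [form_self_nonneg_of_isTangent M hx (hY.tangent x hx)]

theorem IsVectorField.add_smul {σ φ : Ambient n → Ambient n} (hσ : IsVectorField M σ)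
    (hφ : IsVectorField M φ) (t : ℝ) : IsVectorField M fun x => σ x + t • φ x where
  smooth := hσ.smooth.add (hφ.smooth.const_smul t)
  tangent x hx := by
    have h1 : form M x (σ x) = 0 := hσ.tangent x hx
    have h2 : form M x (φ x) = 0 := hφ.tangent x hx
    rw [IsTangent, form_add_right, form_smul_right, h1, h2, mul_zero, add_zero]

theorem IsVectorField.contDiff_one {Y : Ambient n → Ambient n} (hY : IsVectorField M Y) :
    ContDiff ℝ 1 Y :=
  hY.smooth.of_le (by exact_mod_cast le_top)

/-- At a fixed point both the field and its covariant derivatives are affine in `t`, so the density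
is a real power of a positive quadratic times a polynomial in `t`. -/
theorem hasDerivAt_verticalEnergyDensity (p q : ℝ) {σ φ : Ambient n → Ambient n}
    (hσ : IsVectorField M σ) (hφ : IsVectorField M φ) {x : Ambient n} (hx : x ∈ points M n)
    (t : ℝ) :
    HasDerivAt (fun t : ℝ => verticalEnergyDensity M p q (fun x => σ x + t • φ x) x)
      (densityVariation M p q (fun x => σ x + t • φ x) φ x) t := by
  have hσd := hσ.contDiff_one.differentiable (by simp)
  have hφd := hφ.contDiff_one.differentiable (by simp)
  simp only [verticalEnergyDensity_eq M p q hx, densityVariation, covBasis_add_smul M hσd hφd]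
  have hY := hasDerivAt_add_smul (σ x) (φ x) t
  have hN := fun i => hasDerivAt_add_smul (covBasis M σ i x) (covBasis M φ i x) t
  have hW := ((hY.spaceForm_form M hY).const_add 1).rpow_const (p := -p)
    (Or.inl (one_add_form_self_pos (hσ.add_smul hφ t) hx).ne')
  have hQ := HasDerivAt.fun_sum (u := Finset.univ) fun i _ =>
    (((hN i).spaceForm_form M (hN i)).add
      ((((hN i).spaceForm_form M hY).pow 2).const_mul q)).const_mul (signature M i)
  refine ((hW.mul hQ).const_mul (1 / 2)).congr_deriv ?_
  congr 1
  congr 1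
  · rw [form_comm M (σ x + t • φ x) (φ x)]
    simp only [Pi.add_apply, Pi.pow_apply]
    ring
  · congr 1
    refine Finset.sum_congr rfl fun i _ => ?_
    rw [form_comm M (covBasis M φ i x) (covBasis M σ i x + _)]
    push_cast
    ring

theorem continuousOn_densityVariation (p q : ℝ) {σ φ : Ambient n → Ambient n}
    (hσ : IsVectorField M σ) (hφ : IsVectorField M φ) :
    ContinuousOn (fun z : ℝ × Ambient n =>
      densityVariation M p q (fun x => σ x + z.1 • φ x) φ z.2) (Set.univ ×ˢ points M n) := by
  have hσd := hσ.contDiff_one.differentiable (by simp)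
  have hφd := hφ.contDiff_one.differentiable (by simp)
  simp only [densityVariation, covBasis_add_smul M hσd hφd]
  have hφ' : Continuous fun z : ℝ × Ambient n => φ z.2 := hφ.smooth.continuous.comp continuous_snd
  have hY : Continuous fun z : ℝ × Ambient n => σ z.2 + z.1 • φ z.2 :=
    (hσ.smooth.continuous.comp continuous_snd).add (continuous_fst.smul hφ')
  have hL := fun i => (continuous_covBasis M hφ.contDiff_one i).comp
    (continuous_snd (X := ℝ) (Y := Ambient n))
  have hN := fun i => ((continuous_covBasis M hσ.contDiff_one i).comp
    (continuous_snd (X := ℝ) (Y := Ambient n))).add (continuous_fst.smul (hL i))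
  have hW := continuous_const (y := (1 : ℝ)).add (hY.spaceForm_form M hY)
  have hWp : ∀ s : ℝ, ContinuousOn (fun z : ℝ × Ambient n =>
      (1 + form M (σ z.2 + z.1 • φ z.2) (σ z.2 + z.1 • φ z.2)) ^ s) (Set.univ ×ˢ points M n) :=
    fun s => hW.continuousOn.rpow_const fun z hz =>
      Or.inl (one_add_form_self_pos (hσ.add_smul hφ z.1) hz.2).ne'
  have hQ := continuous_finsetSum Finset.univ fun i _ =>
    (continuous_const (y := signature M i)).mul (((hN i).spaceForm_form M (hN i)).add
      (continuous_const (y := q).mul (((hN i).spaceForm_form M hY).pow 2)))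
  have hQ' := continuous_finsetSum Finset.univ fun i _ =>
    (continuous_const (y := signature M i)).mul
      ((continuous_const (y := (2 : ℝ)).mul ((hN i).spaceForm_form M (hL i))).add
      ((continuous_const (y := 2 * q).mul ((hN i).spaceForm_form M hY)).mul
        (((hL i).spaceForm_form M hY).add ((hN i).spaceForm_form M hφ'))))
  exact continuousOn_const.mul ((((continuous_const (y := (2 : ℝ)).mul
    (hφ'.spaceForm_form M hY)).mul continuous_const).continuousOn.mul (hWp _)).mul
      hQ.continuousOn |>.add ((hWp _).mul hQ'.continuousOn))

theorem continuousOn_verticalEnergyDensity (p q : ℝ) {Y : Ambient n → Ambient n}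
    (hY : IsVectorField M Y) : ContinuousOn (verticalEnergyDensity M p q Y) (points M n) := by
  have hN := continuous_covBasis M hY.contDiff_one
  have hYc := hY.smooth.continuous
  refine ContinuousOn.congr ?_ fun x hx => verticalEnergyDensity_eq M p q hx Y
  refine continuousOn_const.mul (((continuous_const.add
    (hYc.spaceForm_form M hYc)).continuousOn.rpow_const fun x hx =>
      Or.inl (one_add_form_self_pos hY hx).ne').mul (Continuous.continuousOn ?_))
  exact continuous_finsetSum _ fun i _ => continuous_const.mul
    (((hN i).spaceForm_form M (hN i)).add
      (continuous_const.mul (((hN i).spaceForm_form M hYc).pow 2)))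

/-- The first variation of the vertical energy. -/
theorem hasDerivAt_verticalEnergy (p q : ℝ) {σ φ : Ambient n → Ambient n}
    (hσ : IsVectorField M σ) (hφ : IsVectorField M φ) {K : Set (Ambient n)} (hK : IsCompact K) :
    HasDerivAt (fun t : ℝ => verticalEnergy M p q K (fun x => σ x + t • φ x))
      (∫ x in K, densityVariation M p q σ φ x ∂volumeMeasure M n) 0 := by
  -- The measure lives on the space form, and the densities are known to be continuous only there.
  have hr : ∀ f : Ambient n → ℝ, ∫ x in K, f x ∂volumeMeasure M n =
      ∫ x in K ∩ points M n, f x ∂volumeMeasure M n := fun f => by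
    refine setIntegral_congr_set ?_
    filter_upwards [ae_mem_points M] with x hx
    exact propext ⟨fun h => ⟨h, hx⟩, fun h => h.1⟩
  have hKM : IsCompact (K ∩ points M n) := hK.inter_right (isClosed_points M)
  simp only [verticalEnergy, hr]
  have h := hasDerivAt_setIntegral_of_continuousOn (ν := volumeMeasure M n) hKM hKM.measurableSet
    hKM.measure_lt_top
    (f := fun t => verticalEnergyDensity M p q fun x => σ x + t • φ x)
    (f' := fun t => densityVariation M p q (fun x => σ x + t • φ x) φ)
    (fun t => (continuousOn_verticalEnergyDensity p q (hσ.add_smul hφ t)).mono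
      Set.inter_subset_right)
    ((continuousOn_densityVariation p q hσ hφ).mono
      (Set.prod_mono subset_rfl Set.inter_subset_right))
    (fun t x hx => hasDerivAt_verticalEnergyDensity p q hσ hφ hx.2 t) 0
  simpa using h

end FirstVariation

/-! ### The first variation at a conformal gradient field as a divergence plus a zeroth-order term.
-/

section EulerLagrange

open MeasureTheory Filter Topology

variable (M : Kind) {n : ℕ}

/-- The quadratic polynomial in `α²` whose vanishing is the Euler-Lagrange equation of a conformal
gradient field. -/
def tensionPoly (ε n p q μ s : ℝ) : ℝ :=
  ε * (1 + μ) * (1 + q * μ) + (-1 + (2 - n) * p + q * ((p - 2 - n) * μ - 1 - n)) * s +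
    q * ε * (1 + n - p) * s ^ 2

/-- The conformal gradient field with pole `a`, extended affinely in `x`. -/
def poleField (a x : Ambient n) : Ambient n := a - (M.sign * form M a x) • x

/-- The function `1 + |σ|²`, extended to the ambient space as a polynomial. -/
def poleWeight (a x : Ambient n) : ℝ := 1 + (form M a a - M.sign * form M a x ^ 2)

/-- The vector field whose divergence is the exact part of the first variation. -/
def energyCurrent (p q : ℝ) (a : Ambient n) (φ : Ambient n → Ambient n) (x : Ambient n) :
    Ambient n :=
  (M.sign * form M a x * poleWeight M a x ^ (-p)) •
    (φ x + (q * form M (φ x) (poleField M a x)) • poleField M a x)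

variable {M} (a : Ambient n)

/-- `poleField` is a simpler polynomial extension of `σ` than `conformalGradient`. The two agree on
the space form, and the current may use either, since its tangential derivatives there see only
those values. -/
theorem poleField_of_mem {x : Ambient n} (hx : x ∈ points M n) :
    poleField M a x = conformalGradient M a x :=
  (conformalGradient_of_mem M a hx).symm

theorem poleWeight_of_mem {x : Ambient n} (hx : x ∈ points M n) :
    poleWeight M a x = 1 + form M (conformalGradient M a x) (conformalGradient M a x) := by
  rw [form_conformalGradient_self M a hx, poleWeight]

theorem poleWeight_pos {x : Ambient n} (hx : x ∈ points M n) : 0 < poleWeight M a x := by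
  rw [poleWeight_of_mem a hx]
  exact one_add_form_self_pos (isVectorField_conformalGradient M a) hx

theorem contDiff_form_pole : ContDiff ℝ 1 fun x : Ambient n => form M a x :=
  contDiff_const.spaceForm_form M contDiff_id

theorem contDiff_poleField : ContDiff ℝ 1 (poleField M a) :=
  contDiff_const.sub ((contDiff_const.mul (contDiff_form_pole a)).smul contDiff_id)

theorem contDiff_poleWeight : ContDiff ℝ 1 (poleWeight M a) :=
  contDiff_const.add (contDiff_const.sub (contDiff_const.mul ((contDiff_form_pole a).pow 2)))

theorem contDiffAt_energyCurrent (p q : ℝ) {φ : Ambient n → Ambient n} (hφ : ContDiff ℝ 1 φ)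
    {x : Ambient n} (hx : x ∈ points M n) : ContDiffAt ℝ 1 (energyCurrent M p q a φ) x := by
  have h1 : ContDiffAt ℝ 1 (fun x => M.sign * form M a x * poleWeight M a x ^ (-p)) x :=
    (contDiff_const.mul (contDiff_form_pole a)).contDiffAt.mul
      ((contDiff_poleWeight a).contDiffAt.rpow_const_of_ne (poleWeight_pos a hx).ne')
  have h2 : ContDiff ℝ 1
      fun x => φ x + (q * form M (φ x) (poleField M a x)) • poleField M a x :=
    hφ.add ((contDiff_const.mul (hφ.spaceForm_form M (contDiff_poleField a))).smul
      (contDiff_poleField a))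
  exact h1.smul h2.contDiffAt

theorem hasDerivAt_form_pole_line (x X : Ambient n) :
    HasDerivAt (fun t : ℝ => form M a (x + t • X)) (form M a X) 0 :=
  ((hasDerivAt_const (0 : ℝ) a).spaceForm_form M (hasDerivAt_add_smul x X 0)).congr_deriv
    (by simp [form_zero_left])

theorem hasDerivAt_poleField_line (x X : Ambient n) :
    HasDerivAt (fun t : ℝ => poleField M a (x + t • X))
      (-((M.sign * form M a x) • X + (M.sign * form M a X) • x)) 0 :=
  ((((hasDerivAt_form_pole_line a x X).const_mul M.sign).smul
    (hasDerivAt_add_smul x X 0)).const_sub a).congr_deriv (by simp)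

theorem hasDerivAt_poleWeight_rpow_line (p : ℝ) {x : Ambient n} (hx : x ∈ points M n)
    (X : Ambient n) :
    HasDerivAt (fun t : ℝ => poleWeight M a (x + t • X) ^ (-p))
      (2 * p * M.sign * form M a x * form M a X * poleWeight M a x ^ (-p - 1)) 0 := by
  have h : HasDerivAt (fun t : ℝ => poleWeight M a (x + t • X))
      (-(M.sign * (2 * form M a x * form M a X))) 0 :=
    (((((hasDerivAt_form_pole_line a x X).pow 2).const_mul M.sign).const_sub
      (form M a a)).const_add 1).congr_deriv (by simp)
  refine (h.rpow_const (p := -p) (Or.inl ?_)).congr_deriv ?_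
  · simpa using (poleWeight_pos a hx).ne'
  · simp only [zero_smul, add_zero]
    ring

theorem fderiv_energyCurrent (p q : ℝ) {φ : Ambient n → Ambient n} (hφ : IsVectorField M φ)
    {x X : Ambient n} (hx : x ∈ points M n) :
    fderiv ℝ (energyCurrent M p q a φ) x X =
      (form M a X * (M.sign * poleWeight M a x ^ (-p) +
        2 * p * form M a x ^ 2 * poleWeight M a x ^ (-p - 1))) •
          (φ x + (q * form M (φ x) (poleField M a x)) • poleField M a x) +
      (M.sign * form M a x * poleWeight M a x ^ (-p)) •
        (fderiv ℝ φ x X +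
          (q * (form M (fderiv ℝ φ x X) (poleField M a x) -
            M.sign * form M a x * form M (φ x) X)) • poleField M a x -
          (q * form M (φ x) (poleField M a x)) •
            ((M.sign * form M a x) • X + (M.sign * form M a X) • x)) := by
  refine fderiv_eq_of_hasDerivAt_line
    ((contDiffAt_energyCurrent a p q hφ.contDiff_one hx).differentiableAt (by simp)) ?_
  have hα := hasDerivAt_form_pole_line (M := M) a x X
  have hP := hasDerivAt_poleField_line (M := M) a x X
  have hw := hasDerivAt_poleWeight_rpow_line a p hx X
  have hφ' := hasDerivAt_line (hφ.contDiff_one.differentiable (by simp) x) X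
  have hT : form M (φ x) x = 0 := by
    rw [form_comm]
    exact hφ.tangent x hx
  refine (((hα.const_mul M.sign).mul hw).smul
    (hφ'.add (((hφ'.spaceForm_form M hP).const_mul q).smul hP))).congr_deriv ?_
  simp only [Pi.mul_apply, Pi.add_apply, Pi.smul_apply', zero_smul, add_zero]
  have e1 : M.sign * form M a X * poleWeight M a x ^ (-p) + M.sign * form M a x *
      (2 * p * M.sign * form M a x * form M a X * poleWeight M a x ^ (-p - 1)) =
      form M a X * (M.sign * poleWeight M a x ^ (-p) +
        2 * p * form M a x ^ 2 * poleWeight M a x ^ (-p - 1)) := by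
    linear_combination (2 * p * form M a x ^ 2 * form M a X * poleWeight M a x ^ (-p - 1)) *
      sign_mul_sign M
  have e2 : form M (φ x) (-((M.sign * form M a x) • X + (M.sign * form M a X) • x)) =
      -(M.sign * form M a x * form M (φ x) X) := by
    rw [← neg_one_smul ℝ, form_smul_right, form_add_right, form_smul_right, form_smul_right, hT]
    ring
  rw [e1, e2, smul_neg, add_comm]
  congr 2
  abel_nf

theorem surfaceDiv_energyCurrent (p q : ℝ) {φ : Ambient n → Ambient n} (hφ : IsVectorField M φ)
    {x : Ambient n} (hx : x ∈ points M n) :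
    surfaceDiv M (energyCurrent M p q a φ) x =
      (M.sign * poleWeight M a x ^ (-p) +
        2 * p * form M a x ^ 2 * poleWeight M a x ^ (-p - 1)) *
          (1 + q * (poleWeight M a x - 1)) * form M (φ x) (conformalGradient M a x) +
      M.sign * form M a x * poleWeight M a x ^ (-p) *
        (surfaceDiv M φ x + q * (form M (fderiv ℝ φ x (conformalGradient M a x))
          (conformalGradient M a x) -
            M.sign * form M a x * (1 + n) * form M (φ x) (conformalGradient M a x))) := by
  have hσT := (isVectorField_conformalGradient M a).tangent x hx
  -- The only traces needed: `s1` to `s3` contract with `σ` and give `⟨σ, φ⟩`, `|σ|²` and `⟨D_σ φ,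
  -- σ⟩`; `s4` gives the dimension.
  have s1 := sum_signature_mul_map M hσT (formBilin M (φ x))
  have s2 := sum_signature_mul_map M hσT (formBilin M (conformalGradient M a x))
  have s3 := sum_signature_mul_map M hσT
    ((formBilin M).flip (conformalGradient M a x) ∘ₗ (fderiv ℝ φ x).toLinearMap)
  have s4 := sum_signature_form_tangentBasisVec_self M hx
  simp only [formBilin_apply, LinearMap.comp_apply, LinearMap.flip_apply,
    ContinuousLinearMap.coe_coe] at s1 s2 s3
  have hw : form M (conformalGradient M a x) (conformalGradient M a x) = poleWeight M a x - 1 := by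
    rw [poleWeight_of_mem a hx]
    ring
  rw [hw] at s2
  have hterm : ∀ i, signature M i * form M (fderiv ℝ (energyCurrent M p q a φ) x
      (tangentBasisVec M x i)) (tangentBasisVec M x i) =
      (M.sign * poleWeight M a x ^ (-p) +
        2 * p * form M a x ^ 2 * poleWeight M a x ^ (-p - 1) -
          M.sign * form M a x * poleWeight M a x ^ (-p) * q * M.sign * form M a x) *
        (signature M i * (form M (conformalGradient M a x) (tangentBasisVec M x i) *
          form M (φ x) (tangentBasisVec M x i))) +
      (M.sign * poleWeight M a x ^ (-p) +
        2 * p * form M a x ^ 2 * poleWeight M a x ^ (-p - 1)) * q *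
          form M (φ x) (conformalGradient M a x) *
        (signature M i * (form M (conformalGradient M a x) (tangentBasisVec M x i) *
          form M (conformalGradient M a x) (tangentBasisVec M x i))) +
      M.sign * form M a x * poleWeight M a x ^ (-p) *
        (signature M i * form M (fderiv ℝ φ x (tangentBasisVec M x i)) (tangentBasisVec M x i)) +
      M.sign * form M a x * poleWeight M a x ^ (-p) * q *
        (signature M i * (form M (conformalGradient M a x) (tangentBasisVec M x i) *
          form M (fderiv ℝ φ x (tangentBasisVec M x i)) (conformalGradient M a x))) -
      M.sign * form M a x * poleWeight M a x ^ (-p) * q *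
          form M (φ x) (conformalGradient M a x) * (M.sign * form M a x) *
        (signature M i * form M (tangentBasisVec M x i) (tangentBasisVec M x i)) := fun i => by
    have hb : form M x (tangentBasisVec M x i) = 0 := isTangent_tangentBasisVec M hx i
    rw [fderiv_energyCurrent a p q hφ hx, poleField_of_mem a hx,
      ← form_conformalGradient_of_isTangent M a hx (isTangent_tangentBasisVec M hx i)]
    simp only [form_add_left, form_sub_left, form_smul_left, hb]
    ring
  rw [surfaceDiv]
  simp only [hterm, Finset.sum_add_distrib, Finset.sum_sub_distrib, ← Finset.mul_sum, s1, s2, s3,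
    s4]
  rw [← surfaceDiv]
  ring

/-- Because `∇_X σ = -εα X`, the terms with derivatives of `φ` are exactly those in minus the
divergence of `energyCurrent`. The remainder is algebraic in `φ` and proportional to `⟨φ, σ⟩`. -/
theorem densityVariation_conformalGradient (p q : ℝ) {φ : Ambient n → Ambient n}
    (hφ : IsVectorField M φ) {x : Ambient n} (hx : x ∈ points M n) :
    densityVariation M p q (conformalGradient M a) φ x =
      -surfaceDiv M (energyCurrent M p q a φ) x +
        tensionPoly M.sign n p q (form M a a) (form M a x ^ 2) *
          form M (φ x) (conformalGradient M a x) * poleWeight M a x ^ (-p - 1) := by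
  have hσT := (isVectorField_conformalGradient M a).tangent x hx
  have s1 := sum_signature_mul_map M hσT (formBilin M (φ x))
  have s2 := sum_signature_mul_map M hσT (formBilin M (conformalGradient M a x))
  have s3 := sum_signature_mul_map M hσT
    ((formBilin M).flip (conformalGradient M a x) ∘ₗ (fderiv ℝ φ x).toLinearMap)
  have s4 := sum_signature_form_tangentBasisVec_self M hx
  simp only [formBilin_apply, LinearMap.comp_apply, LinearMap.flip_apply,
    ContinuousLinearMap.coe_coe] at s1 s2 s3
  have hw : form M (conformalGradient M a x) (conformalGradient M a x) = poleWeight M a x - 1 := by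
    rw [poleWeight_of_mem a hx]
    ring
  rw [hw] at s2
  have hN : ∀ i, covBasis M (conformalGradient M a) i x =
      -(M.sign * form M a x) • tangentBasisVec M x i := fun i =>
    covDeriv_conformalGradient M a hx (isTangent_tangentBasisVec M hx i)
  have t1 : ∀ i, signature M i * (form M (covBasis M (conformalGradient M a) i x)
      (covBasis M (conformalGradient M a) i x) +
      q * form M (covBasis M (conformalGradient M a) i x) (conformalGradient M a x) ^ 2) =
      (M.sign * form M a x) ^ 2 *
        (signature M i * form M (tangentBasisVec M x i) (tangentBasisVec M x i)) +
      (M.sign * form M a x) ^ 2 * q *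
        (signature M i * (form M (conformalGradient M a x) (tangentBasisVec M x i) *
          form M (conformalGradient M a x) (tangentBasisVec M x i))) := fun i => by
    rw [hN, form_comm M (_ • _) (conformalGradient M a x)]
    simp only [form_smul_left, form_smul_right]
    ring
  have t2 : ∀ i, signature M i * (2 * form M (covBasis M (conformalGradient M a) i x)
      (covBasis M φ i x) +
        2 * q * form M (covBasis M (conformalGradient M a) i x) (conformalGradient M a x) *
          (form M (covBasis M φ i x) (conformalGradient M a x) +
            form M (covBasis M (conformalGradient M a) i x) (φ x))) =
      -(2 * (M.sign * form M a x)) *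
        (signature M i * form M (fderiv ℝ φ x (tangentBasisVec M x i)) (tangentBasisVec M x i)) +
      -(2 * q * (M.sign * form M a x)) *
        (signature M i * (form M (conformalGradient M a x) (tangentBasisVec M x i) *
          form M (fderiv ℝ φ x (tangentBasisVec M x i)) (conformalGradient M a x))) +
      2 * q * (M.sign * form M a x) ^ 2 *
        (signature M i * (form M (conformalGradient M a x) (tangentBasisVec M x i) *
          form M (φ x) (tangentBasisVec M x i))) := fun i => by
    rw [hN, form_comm M (_ • _) (conformalGradient M a x), form_comm M (_ • _) (covBasis M φ i x),
      form_comm M (_ • _) (φ x)]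
    simp only [form_smul_right]
    rw [covBasis, covDeriv, form_tangentProj_left M (isTangent_tangentBasisVec M hx i),
      form_tangentProj_left M hσT]
    ring
  rw [densityVariation, surfaceDiv_energyCurrent a p q hφ hx]
  simp only [t1, t2, Finset.sum_add_distrib, ← Finset.mul_sum, s1, s2, s3, s4]
  rw [← surfaceDiv, ← poleWeight_of_mem a hx]
  -- Reduces both powers to the single factor `w^(-p-1)`, after which the claim is a polynomial
  -- identity for each value of `ε`.
  have hpow : poleWeight M a x ^ (-p) = poleWeight M a x ^ (-p - 1) * poleWeight M a x := by
    rw [← Real.rpow_add_one (poleWeight_pos a hx).ne']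
    congr 1
    ring
  rw [hpow]
  generalize poleWeight M a x ^ (-p - 1) = W
  have hε := sign_mul_sign M
  have hw' : poleWeight M a x = 1 + (form M a a - M.sign * form M a x ^ 2) := rfl
  rw [hw', tensionPoly]
  generalize surfaceDiv M φ x = D
  generalize form M (fderiv ℝ φ x (conformalGradient M a x)) (conformalGradient M a x) = G
  generalize form M (φ x) (conformalGradient M a x) = g
  generalize form M a a = μ
  generalize form M a x = α
  cases M <;> simp only [Kind.sign] <;> ring

end EulerLagrange

/-! ### The Euler–Lagrange criterion. -/

section Criterion

open MeasureTheory Filter Topology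

variable {M : Kind} {n : ℕ} (a : Ambient n)

theorem isTangent_energyCurrent (p q : ℝ) {φ : Ambient n → Ambient n} (hφ : IsVectorField M φ)
    {x : Ambient n} (hx : x ∈ points M n) : IsTangent M x (energyCurrent M p q a φ x) := by
  have h1 : form M x (φ x) = 0 := hφ.tangent x hx
  have h2 : form M x (conformalGradient M a x) = 0 :=
    (isVectorField_conformalGradient M a).tangent x hx
  rw [IsTangent, energyCurrent, poleField_of_mem a hx]
  simp [form_smul_right, form_add_right, h1, h2]

theorem continuous_form_pole : Continuous fun x : Ambient n => form M a x :=
  (contDiff_form_pole a).continuous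

theorem continuous_tensionPoly (ε m p q μ : ℝ) : Continuous (tensionPoly ε m p q μ) := by
  unfold tensionPoly
  fun_prop

/-- The first variation of the vertical energy at a conformal gradient field. -/
theorem setIntegral_densityVariation (p q : ℝ) {φ : Ambient n → Ambient n}
    (hφ : IsVectorField M φ) {K : Set (Ambient n)} (hK : IsCompact K) (hφK : tsupport φ ⊆ K) :
    Integrable (fun x => tensionPoly M.sign n p q (form M a a) (form M a x ^ 2) *
        form M (φ x) (conformalGradient M a x) * poleWeight M a x ^ (-p - 1))
        (volumeMeasure M n) ∧
      ∫ x in K, densityVariation M p q (conformalGradient M a) φ x ∂volumeMeasure M n =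
        ∫ x, tensionPoly M.sign n p q (form M a a) (form M a x ^ 2) *
          form M (φ x) (conformalGradient M a x) * poleWeight M a x ^ (-p - 1)
          ∂volumeMeasure M n := by
  set h : Ambient n → ℝ := fun x => tensionPoly M.sign n p q (form M a a) (form M a x ^ 2) *
        form M (φ x) (conformalGradient M a x) * poleWeight M a x ^ (-p - 1) with hdef
  have hφ0 : ∀ x ∉ K, φ x = 0 := fun x hx => image_eq_zero_of_notMem_tsupport fun h => hx (hφK h)
  have hσc := (isVectorField_conformalGradient M a).smooth.continuous
  have hh0 : ∀ x ∉ K, h x = 0 := fun x hx => by simp [hdef, hφ0 x hx, form_zero_left]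
  have hh : Integrable h (volumeMeasure M n) := by
    refine integrable_of_continuousOn_points M ?_ hK hh0
    exact (((continuous_tensionPoly _ _ _ _ _).comp ((continuous_form_pole a).pow 2)).mul
      (hφ.smooth.continuous.spaceForm_form M hσc)).continuousOn.mul
        ((contDiff_poleWeight a).continuous.continuousOn.rpow_const fun x hx =>
          Or.inl (poleWeight_pos a hx).ne')
  have hZ0 : ∀ x ∉ K, energyCurrent M p q a φ x = 0 := fun x hx => by
    simp [energyCurrent, hφ0 x hx, form_zero_left]
  obtain ⟨hd, hdi⟩ := integral_surfaceDiv_eq_zero M hK hZ0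
    (fun x hx => contDiffAt_energyCurrent a p q hφ.contDiff_one hx)
    (fun x hx => isTangent_energyCurrent a p q hφ hx)
  refine ⟨hh, ?_⟩
  have hdn : Integrable (fun x => -surfaceDiv M (energyCurrent M p q a φ) x)
    (volumeMeasure M n) := hd.neg
  have h1 : ∫ x in K, densityVariation M p q (conformalGradient M a) φ x ∂volumeMeasure M n =
      ∫ x in K, (-surfaceDiv M (energyCurrent M p q a φ) x + h x) ∂volumeMeasure M n := by
    refine integral_congr_ae (ae_restrict_of_ae ?_)
    filter_upwards [ae_mem_points M] with x hx
    exact densityVariation_conformalGradient a p q hφ hx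
  -- The integrand vanishes off `K`, so the integral extends to the whole space and the divergence
  -- term disappears.
  rw [h1, setIntegral_eq_integral_of_forall_compl_eq_zero, integral_add hdn hh, integral_neg,
    hdi, neg_zero, zero_add]
  intro x hx
  rw [surfaceDiv_eq_zero M hK.isClosed hZ0 hx, hh0 x hx, neg_zero, zero_add]

/-- The Euler-Lagrange equation of a conformal gradient field. -/
theorem isPQHarmonic_conformalGradient_iff (p q : ℝ) :
    IsPQHarmonic M p q (conformalGradient M a) ↔ ∀ x ∈ points M n,
      conformalGradient M a x ≠ 0 →
        tensionPoly M.sign n p q (form M a a) (form M a x ^ 2) = 0 := by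
  have hσ := isVectorField_conformalGradient M a
  constructor
  · rintro ⟨-, hcrit⟩ x₀ hx₀ hne
    by_contra hF
    obtain ⟨χ, -, hχc, hχs, hχr, hχ1⟩ :=
      exists_contDiff_tsupport_subset (n := ⊤) (s := Set.univ) (x := x₀) univ_mem
    have hα : ContDiff ℝ ∞ fun x : Ambient n => form M a x :=
      contDiff_const.spaceForm_form M contDiff_id
    set F : Ambient n → ℝ := fun x =>
      tensionPoly M.sign n p q (form M a a) (form M a x ^ 2) with hFdef
    have hFs : ContDiff ℝ ∞ F := by
      have : ContDiff ℝ ∞ (tensionPoly M.sign n p q (form M a a)) := by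
        unfold tensionPoly
        fun_prop
      exact this.comp (hα.pow 2)
    -- With test field `χ F σ` the first variation is the integral of `χ F² |σ|² w^(-p-1) ≥ 0`. Its
    -- vanishing makes the integrand zero almost everywhere, contradicting the positive volume of
    -- the open set where it is positive near `x₀`.
    have hφ : IsVectorField M fun x => (χ x * F x) • conformalGradient M a x :=
      { smooth := (hχs.mul hFs).smul hσ.smooth
        tangent := fun x hx => by
          have h : form M x (conformalGradient M a x) = 0 := hσ.tangent x hx
          rw [IsTangent, form_smul_right, h, mul_zero] }
    have hsupp : tsupport (fun x => (χ x * F x) • conformalGradient M a x) ⊆ tsupport χ :=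
      closure_mono fun x hx => by
        contrapose! hx
        simp [Function.notMem_support.1 hx]
    have hχK : IsCompact (tsupport χ) := hχc
    have hder := (hcrit _ _ hχK hφ hsupp).unique (hasDerivAt_verticalEnergy p q hσ hφ hχK)
    obtain ⟨hint, hval⟩ := setIntegral_densityVariation a p q hφ hχK hsupp
    rw [hval, eq_comm] at hder
    have hχ0 : ∀ x, 0 ≤ χ x := fun x => (hχr ⟨x, rfl⟩).1
    have hform : ∀ x, F x * form M ((χ x * F x) • conformalGradient M a x)
        (conformalGradient M a x) * poleWeight M a x ^ (-p - 1) =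
        χ x * F x ^ 2 * form M (conformalGradient M a x) (conformalGradient M a x) *
          poleWeight M a x ^ (-p - 1) := fun x => by
      rw [form_smul_left]
      ring
    have hnonneg : 0 ≤ᵐ[volumeMeasure M n] fun x => F x *
        form M ((χ x * F x) • conformalGradient M a x)
        (conformalGradient M a x) * poleWeight M a x ^ (-p - 1) := by
      filter_upwards [ae_mem_points M] with x hx
      rw [hform]
      exact mul_nonneg (mul_nonneg (mul_nonneg (hχ0 x) (sq_nonneg _))
        (form_self_nonneg_of_isTangent M hx (hσ.tangent x hx)))
        (Real.rpow_nonneg (poleWeight_pos a hx).le _)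
    have hae := (integral_eq_zero_iff_of_nonneg_ae hnonneg hint).1 hder
    set U : Set (Ambient n) := {x | 0 < χ x * F x ^ 2 *
      form M (conformalGradient M a x) (conformalGradient M a x)} with hU
    have hUo : IsOpen U := isOpen_lt continuous_const
      ((hχs.continuous.mul (hFs.continuous.pow 2)).mul
        (hσ.smooth.continuous.spaceForm_form M hσ.smooth.continuous))
    have hx₀U : x₀ ∈ U := by
      have h1 := form_self_pos_of_isTangent M hx₀ (hσ.tangent x₀ hx₀) hne
      have h2 : F x₀ ≠ 0 := hF
      rw [hU, Set.mem_ofPred_eq, hχ1]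
      positivity
    refine (volumeMeasure_pos M hUo hx₀ hx₀U).ne' ?_
    have hnot : ∀ᵐ x ∂volumeMeasure M n, x ∉ U := by
      filter_upwards [hae, ae_mem_points M] with x hx hxM hxU
      rw [hform] at hx
      exact (mul_pos hxU (Real.rpow_pos_of_pos (poleWeight_pos a hxM) _)).ne' hx
    simpa using measure_eq_zero_iff_ae_notMem.2 hnot
  · refine fun hF => ⟨hσ, fun K φ hK hφ hφK => ?_⟩
    refine (hasDerivAt_verticalEnergy p q hσ hφ hK).congr_deriv ?_
    rw [(setIntegral_densityVariation a p q hφ hK hφK).2]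
    refine integral_eq_zero_of_ae ?_
    filter_upwards [ae_mem_points M] with x hx
    by_cases h : conformalGradient M a x = 0
    · simp [h, form_zero_right]
    · simp [hF x hx h]

end Criterion

/-! ### From the Euler–Lagrange equation to equations for `p`, `q`, `μ`; zeros of the field. -/

section Parameters

variable {M : Kind} {n : ℕ} (a : Ambient n)

/-- The geodesic through `x` in the direction of the unit tangent vector `u`, in a
reparametrisation. -/
theorem sqrt_smul_add_smul_mem_points {x u : Ambient n} (hx : x ∈ points M n)
    (hu : IsTangent M x u) (hu1 : form M u u = 1) {s : ℝ} (hs : s ^ 2 ≤ 1) :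
    √(1 - M.sign * s ^ 2) • x + s • u ∈ points M n := by
  have h0 : form M x u = 0 := hu
  have hc : 0 ≤ 1 - M.sign * s ^ 2 := by
    cases M <;> simp only [Kind.sign] <;> nlinarith
  have hsq := Real.sq_sqrt hc
  have hc0 := Real.sqrt_nonneg (1 - M.sign * s ^ 2)
  generalize √(1 - M.sign * s ^ 2) = c at hsq hc0
  have hf : form M (c • x + s • u) (c • x + s • u) = M.sign := by
    simp only [form_add_left, form_add_right, form_smul_left, form_smul_right, form_comm M u x,
      h0, hu1, form_self_of_mem M hx]
    linear_combination M.sign * hsq - s ^ 2 * sign_mul_sign M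
  cases M
  · exact hf
  · refine ⟨hf, ?_⟩
    have h1 := sq_last_le_of_isTangent hx hu
    have h2 := hx.2
    simp only [hu1, Kind.sign, PiLp.add_apply, PiLp.smul_apply, smul_eq_mul] at h1 hsq ⊢
    -- Here `c² = 1 + s²` and `uₙ₊₁² ≤ xₙ₊₁² - 1`, so the first term dominates and the curve stays
    -- on the upper sheet.
    have h3 : |s * u (Fin.last n)| < c * x (Fin.last n) := by
      refine abs_lt_of_sq_lt_sq ?_ (by positivity)
      rw [mul_pow, mul_pow, hsq]
      nlinarith [sq_nonneg s, sq_nonneg (x (Fin.last n))]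
    linarith [(abs_lt.1 h3).1]

/-- Along the curve leaving `x` in the direction `σ/|σ|`, the potential is `√(1 - εs²) α(x) + s
|σ(x)|`. The square root is even in `s`, so the values at `±1` differ, and the interval between them
is attained. -/
theorem infinite_image_form_pole (h : ∃ x ∈ points M n, conformalGradient M a x ≠ 0) :
    ((fun x => form M a x) '' points M n).Infinite := by
  obtain ⟨x, hx, hne⟩ := h
  have hT := (isVectorField_conformalGradient M a).tangent x hx
  have hpos := form_self_pos_of_isTangent M hx hT hne
  set b := √(form M (conformalGradient M a x) (conformalGradient M a x)) with hb
  have hb0 : 0 < b := Real.sqrt_pos.2 hpos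
  have hbb : b * b = form M (conformalGradient M a x) (conformalGradient M a x) :=
    Real.mul_self_sqrt hpos.le
  set u := b⁻¹ • conformalGradient M a x with hu
  have hTu : IsTangent M x u := by
    have h0 : form M x (conformalGradient M a x) = 0 := hT
    rw [IsTangent, hu, form_smul_right, h0, mul_zero]
  have hu1 : form M u u = 1 := by
    rw [hu, form_smul_left, form_smul_right, ← hbb]
    field_simp
  have hau : form M a u = b := by
    rw [← form_conformalGradient_of_isTangent M a hx hTu, hu, form_smul_right, ← hbb]
    field_simp
  set f : ℝ → ℝ := fun s => form M a (√(1 - M.sign * s ^ 2) • x + s • u) with hf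
  have hfe : ∀ s, f s = √(1 - M.sign * s ^ 2) * form M a x + s * b := fun s => by
    simp only [hf, form_add_right, form_smul_right, hau]
  have hfc : Continuous f := by
    rw [show f = fun s => √(1 - M.sign * s ^ 2) * form M a x + s * b from funext hfe]
    fun_prop
  have hlt : f (-1) < f 1 := by
    rw [hfe, hfe]
    simp only [even_two.neg_pow]
    linarith
  refine (Set.Icc_infinite hlt).mono fun y hy => ?_
  obtain ⟨s, hs, rfl⟩ := intermediate_value_Icc (by norm_num : (-1 : ℝ) ≤ 1) hfc.continuousOn hy
  exact ⟨_, sqrt_smul_add_smul_mem_points hx hTu hu1 (by nlinarith [hs.1, hs.2]), rfl⟩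

open Polynomial in
-- The factor `μ - ε t²` stands for `|σ|²`: with it the equation also holds at zeros of `σ`, so no
-- point has to be excluded. As a nonzero polynomial it can then be cancelled.
theorem eq_zero_of_infinite_sq_roots {c₀ c₁ c₂ μ ε : ℝ} (hε : ε ≠ 0) {S : Set ℝ}
    (hS : S.Infinite)
    (h : ∀ t ∈ S, (c₀ + c₁ * t ^ 2 + c₂ * (t ^ 2) ^ 2) * (μ - ε * t ^ 2) = 0) :
    c₀ = 0 ∧ c₁ = 0 ∧ c₂ = 0 := by
  have h0 : (C c₀ + C c₁ * X ^ 2 + C c₂ * X ^ 4 : ℝ[X]) * (C μ - C ε * X ^ 2) = 0 := by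
    refine Polynomial.eq_zero_of_infinite_isRoot _ (hS.mono fun t ht => ?_)
    simpa [IsRoot, ← pow_mul] using h t ht
  have h1 : (C μ - C ε * X ^ 2 : ℝ[X]) ≠ 0 := fun h => hε (by
    simpa [coeff_C] using congrArg (fun p => coeff p 2) h)
  have h2 := (mul_eq_zero.1 h0).resolve_right h1
  refine ⟨?_, ?_, ?_⟩
  · simpa using congrArg (fun p => coeff p 0) h2
  · simpa [coeff_C, coeff_X_pow] using congrArg (fun p => coeff p 2) h2
  · simpa [coeff_C, coeff_X_pow] using congrArg (fun p => coeff p 4) h2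

/-- The algebraic equations for the metric parameters of a conformal gradient field. -/
theorem isPQHarmonic_conformalGradient_iff_eqs
    (h : ∃ x ∈ points M n, conformalGradient M a x ≠ 0) (p q : ℝ) :
    IsPQHarmonic M p q (conformalGradient M a) ↔
      (1 + form M a a) * (1 + q * form M a a) = 0 ∧
      -1 + (2 - n) * p + q * ((p - 2 - n) * form M a a - 1 - n) = 0 ∧ q * (1 + n - p) = 0 := by
  have hε : M.sign ≠ 0 := fun h => by simpa [h] using sign_mul_sign M
  rw [isPQHarmonic_conformalGradient_iff]
  constructor
  · intro hF
    obtain ⟨h0, h1, h2⟩ := eq_zero_of_infinite_sq_roots (μ := form M a a)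
      (c₀ := M.sign * (1 + form M a a) * (1 + q * form M a a))
      (c₁ := -1 + (2 - n) * p + q * ((p - 2 - n) * form M a a - 1 - n))
      (c₂ := q * M.sign * (1 + n - p)) hε (infinite_image_form_pole a h) (by
        rintro _ ⟨x, hx, rfl⟩
        change tensionPoly _ _ _ _ _ _ * _ = 0
        rw [← form_conformalGradient_self M a hx]
        by_cases hx0 : conformalGradient M a x = 0
        · rw [hx0, form_zero_left, mul_zero]
        · rw [hF x hx hx0, zero_mul])
    refine ⟨?_, h1, ?_⟩
    · rw [mul_assoc] at h0
      exact (mul_eq_zero.1 h0).resolve_left hε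
    · rw [mul_comm q, mul_assoc] at h2
      exact (mul_eq_zero.1 h2).resolve_left hε
  · rintro ⟨h0, h1, h2⟩ x - -
    rw [tensionPoly]
    linear_combination M.sign * h0 + form M a x ^ 2 * h1 + M.sign * form M a x ^ 4 * h2

/-- `σ` vanishes at `x` exactly when `a` is a multiple of `x`. In hyperbolic space `a = c x` gives
`μ = -c² < 0`, since `a ≠ 0`; conversely, if `μ < 0` then `a` or `-a` lies on the ray through a
point of `Hⁿ`, which is a zero of `σ`. -/
theorem form_self_nonneg_iff (h : ∃ x ∈ points M n, conformalGradient M a x ≠ 0) :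
    0 ≤ form M a a ↔ M = .sphere ∨
      (M = .hyperbolic ∧ ∀ x ∈ points M n, conformalGradient M a x ≠ 0) := by
  have ha : a ≠ 0 := by
    rintro rfl
    obtain ⟨x, hx, hne⟩ := h
    exact hne (by rw [conformalGradient_of_mem M 0 hx]; simp [form_zero_left])
  cases M
  · simp [(form_sphere_self_pos ha).le]
  · simp only [reduceCtorEq, true_and, false_or]
    constructor
    · intro hμ x hx h0
      rw [conformalGradient_of_mem _ a hx, sub_eq_zero] at h0
      have hx1 : form .hyperbolic x x = -1 := hx.1
      generalize hc : Kind.hyperbolic.sign * form .hyperbolic a x = c at h0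
      rw [h0, form_smul_left, form_smul_right, hx1] at hμ
      have : c = 0 := by
        by_contra hc0
        have : 0 < c ^ 2 := by positivity
        nlinarith
      exact ha (by rw [h0, this, zero_smul])
    · intro hz
      by_contra! hμ
      obtain ⟨t, ht, x, hx, hax⟩ | hneg : a ∈ openCone .hyperbolic n ∨
          -a ∈ openCone .hyperbolic n := by
        -- A vector with vanishing last coordinate has nonnegative square; the sign of this
        -- coordinate decides between `a` and `-a`.
        have hl : a (Fin.last n) ≠ 0 := fun hl => by
          rw [form_eq_sum_castSucc, hl] at hμ
          have : 0 ≤ ∑ i : Fin n, a i.castSucc * a i.castSucc :=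
            Finset.sum_nonneg fun i _ => mul_self_nonneg _
          linarith
        have hn : form .hyperbolic (-a) (-a) = form .hyperbolic a a := by
          simp [← formBilin_apply]
        rcases hl.lt_or_gt with hl | hl
        · exact .inr ((mem_openCone_iff _).2 ⟨by simp [Kind.sign, hn, hμ], fun _ => by
            simpa using hl⟩)
        · exact .inl ((mem_openCone_iff _).2 ⟨by simp [Kind.sign, hμ], fun _ => hl⟩)
      · refine hz x hx ?_
        have hx1 : form .hyperbolic x x = -1 := hx.1
        rw [conformalGradient_of_mem _ a hx, hax, form_smul_left, hx1, Kind.sign]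
        simp
      · obtain ⟨t, ht, x, hx, hax⟩ := hneg
        refine hz x hx ?_
        have hx1 : form .hyperbolic x x = -1 := hx.1
        have hax' : a = (-t) • x := by rw [neg_smul, ← hax, neg_neg]
        rw [conformalGradient_of_mem _ a hx, hax', form_smul_left, hx1, Kind.sign]
        simp

end Parameters

end SpaceForm

end

/-! ### Solving the three equations for the metric parameters. -/

theorem theorem2p2 (M : SpaceForm.Kind) (n : ℕ) (hn : 2 ≤ n) (a : SpaceForm.Ambient n)
    (σ : SpaceForm.Ambient n → SpaceForm.Ambient n) (hσ : σ = SpaceForm.conformalGradient M a)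
    (hσ0 : ∃ x ∈ SpaceForm.points M n, σ x ≠ 0)
    (μ : ℝ) (hμ : μ = SpaceForm.form M a a) :
    ((0 ≤ μ ↔ M = .sphere ∨ (M = .hyperbolic ∧ ∀ x ∈ SpaceForm.points M n, σ x ≠ 0)) ∧
      (0 ≤ μ →
        (SpaceForm.IsHarmonic M σ ↔ 2 < n ∧ μ = 1 / ((n : ℝ) - 2)) ∧
        (SpaceForm.IsHarmonic M σ →
          SpaceForm.metricParameters M σ = {((n : ℝ) + 1, 2 - (n : ℝ))}))) ∧
    ((μ < 0 ↔ M = .hyperbolic ∧ ∃ x ∈ SpaceForm.points M n, σ x = 0) ∧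
      (μ < 0 →
        (SpaceForm.IsHarmonic M σ ↔ μ = -1) ∧
        (SpaceForm.IsHarmonic M σ →
          (n = 2 → SpaceForm.metricParameters M σ = {((3 : ℝ), -(1 / 2 : ℝ))}) ∧
          (2 < n →
            SpaceForm.metricParameters M σ =
              {((n : ℝ) + 1, 1 - (n : ℝ) + 1 / (n : ℝ)), (1 / (2 - (n : ℝ)), (0 : ℝ))} ∧
            (SpaceForm.metricParameters M σ).ncard = 2)))) := by
  subst hσ
  have hsign := SpaceForm.form_self_nonneg_iff a hσ0
  have hmem : ∀ p q : ℝ, SpaceForm.IsPQHarmonic M p q (SpaceForm.conformalGradient M a) ↔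
      (1 + μ) * (1 + q * μ) = 0 ∧
      -1 + (2 - (n : ℝ)) * p + q * ((p - 2 - n) * μ - 1 - n) = 0 ∧ q * (1 + n - p) = 0 := by
    intro p q
    rw [hμ]
    exact SpaceForm.isPQHarmonic_conformalGradient_iff_eqs a hσ0 p q
  rw [← hμ] at hsign
  have hn' : (2 : ℝ) ≤ n := by exact_mod_cast hn
  have hpos : 0 ≤ μ → ∀ p q : ℝ,
      SpaceForm.IsPQHarmonic M p q (SpaceForm.conformalGradient M a) ↔
      (2 < n ∧ μ = 1 / ((n : ℝ) - 2)) ∧ p = n + 1 ∧ q = 2 - n := by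
    intro h0 p q
    rw [hmem]
    constructor
    · rintro ⟨e0, e1, e2⟩
      have e0' : 1 + q * μ = 0 := (mul_eq_zero.1 e0).resolve_left (by linarith)
      have hq : q ≠ 0 := by
        rintro rfl
        norm_num at e0'
      have hp : p = n + 1 := by linarith [(mul_eq_zero.1 e2).resolve_left hq]
      subst hp
      have hq' : q = 2 - n := by
        -- For `p = n + 1` the second equation reads `(n + 1)(2 - n - q) - (1 + qμ) = 0`.
        have : ((n : ℝ) + 1) * (2 - n - q) = 0 := by linear_combination e1 + e0'
        linarith [(mul_eq_zero.1 this).resolve_left (by linarith)]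
      have hn2 : (n : ℝ) - 2 ≠ 0 := fun h => hq (by linarith)
      refine ⟨⟨lt_of_le_of_ne hn fun h => hn2 (by rw [← h]; norm_num), ?_⟩, rfl, hq'⟩
      rw [eq_div_iff hn2]
      rw [hq'] at e0'
      linarith
    · rintro ⟨⟨hlt, hm⟩, rfl, rfl⟩
      have hlt' : (2 : ℝ) < n := by exact_mod_cast hlt
      have hn2 : (n : ℝ) - 2 ≠ 0 := by linarith
      have hμ1 : 1 + (2 - (n : ℝ)) * μ = 0 := by
        rw [hm]
        field_simp
        ring
      refine ⟨by rw [hμ1, mul_zero], ?_, by ring⟩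
      linear_combination -hμ1
  have hneg : μ < 0 → ∀ p q : ℝ,
      SpaceForm.IsPQHarmonic M p q (SpaceForm.conformalGradient M a) ↔
      μ = -1 ∧ ((p = n + 1 ∧ q = 1 - n + 1 / n) ∨ (2 < n ∧ p = 1 / (2 - n) ∧ q = 0)) := by
    intro h0 p q
    have hn0 : (n : ℝ) ≠ 0 := by linarith
    rw [hmem]
    constructor
    · rintro ⟨e0, e1, e2⟩
      by_cases hq : q = 0
      · subst hq
        have hn2 : (2 : ℝ) - n ≠ 0 := fun h => by
          rw [h] at e1
          norm_num at e1
        refine ⟨by linarith, .inr ⟨lt_of_le_of_ne hn fun h => hn2 (by rw [← h]; norm_num), ?_,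
          rfl⟩⟩
        rw [eq_div_iff hn2]
        linarith
      · have hp : p = n + 1 := by linarith [(mul_eq_zero.1 e2).resolve_left hq]
        subst hp
        have hm : μ = -1 := by
          rcases mul_eq_zero.1 e0 with h | h
          · linarith
          -- Again `q = 2 - n`; but then `qμ ≥ 0`, as `q ≤ 0` and `μ < 0`, which contradicts `1 + qμ
          -- = 0`.
          · exfalso
            have : ((n : ℝ) + 1) * (2 - n - q) = 0 := by linear_combination e1 + h
            have hq' : q = 2 - n := by
              linarith [(mul_eq_zero.1 this).resolve_left (by linarith)]
            rw [hq'] at h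
            nlinarith
        refine ⟨hm, .inl ⟨rfl, ?_⟩⟩
        -- For `p = n + 1` and `μ = -1` the second equation becomes `1 + n - n² - nq = 0`.
        rw [hm] at e1
        field_simp
        linarith
    · rintro ⟨rfl, ⟨rfl, rfl⟩ | ⟨hlt, rfl, rfl⟩⟩
      · refine ⟨by norm_num, ?_, by ring⟩
        field_simp
        ring
      · have hlt' : (2 : ℝ) < n := by exact_mod_cast hlt
        have hn2 : (2 : ℝ) - n ≠ 0 := by linarith
        refine ⟨by norm_num, ?_, by ring⟩
        field_simp
        ring
  refine ⟨⟨hsign, fun h0 => ⟨?_, ?_⟩⟩, ⟨?_, fun h0 => ⟨?_, ?_⟩⟩⟩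
  · exact ⟨fun ⟨p, q, h⟩ => ((hpos h0 p q).1 h).1, fun h => ⟨_, _, (hpos h0 _ _).2 ⟨h, rfl, rfl⟩⟩⟩
  · rintro ⟨p₀, q₀, h⟩
    have hc := ((hpos h0 p₀ q₀).1 h).1
    ext ⟨p, q⟩
    simp only [SpaceForm.metricParameters, Set.mem_ofPred_eq, hpos h0, Set.mem_singleton_iff,
      Prod.mk.injEq]
    tauto
  -- The negation of the equivalence in the first part.
  · rw [← not_le, hsign]
    cases M <;> simp
  · exact ⟨fun ⟨p, q, h⟩ => ((hneg h0 p q).1 h).1,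
      fun h => ⟨_, _, (hneg h0 _ _).2 ⟨h, .inl ⟨rfl, rfl⟩⟩⟩⟩
  · rintro ⟨p₀, q₀, h⟩
    have hm := ((hneg h0 p₀ q₀).1 h).1
    refine ⟨fun h2 => ?_, fun h2 => ?_⟩
    · subst h2
      ext ⟨p, q⟩
      simp only [SpaceForm.metricParameters, Set.mem_ofPred_eq, hneg h0, Set.mem_singleton_iff,
        Prod.mk.injEq, lt_irrefl, false_and, or_false]
      norm_num [hm]
    · have hset : SpaceForm.metricParameters M (SpaceForm.conformalGradient M a) =
          {((n : ℝ) + 1, 1 - (n : ℝ) + 1 / (n : ℝ)), (1 / (2 - (n : ℝ)), (0 : ℝ))} := by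
        ext ⟨p, q⟩
        simp only [SpaceForm.metricParameters, Set.mem_ofPred_eq, hneg h0, Set.mem_singleton_iff,
          Set.mem_insert_iff, Prod.mk.injEq]
        tauto
      refine ⟨hset, ?_⟩
      rw [hset, Set.ncard_pair]
      intro heq
      have h1 := congrArg Prod.fst heq
      have hlt' : (2 : ℝ) < n := by exact_mod_cast h2
      -- The two pairs are distinct because their first components have opposite signs.
      have h3 : 1 / (2 - (n : ℝ)) < 0 := by
        rw [one_div]
        exact inv_lt_zero.2 (by linarith)
      simp only at h1
      linarith
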